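/- **Setting.** Fix one of the two categories of spaces: $\Delta$-generated spaces, or $\Delta$-Hausdorff $\Delta$-generated spaces (a space is $\Delta$-generated if its topology is the final one for all continuous maps from the spaces $\mathbb{R}^n$, $n\ge 0$, or equivalently from $[0,1]$; it is $\Delta$-Hausdorff if the image of every continuous map from $[0,1]$ is closed). The $\Delta$-kelleyfication of a space is the same set with the final topology for the continuous maps from the spaces $\mathbb{R}^n$. Let $\mathcal{P}$ be either $\mathcal{G}$ or $\mathcal{M}$, where $\mathcal{G}(1,1)$ is the set of nondecreasing homeomorphisms of $[0,1]$ and $\mathcal{M}(1,1)$ the set of nondecreasing surjective maps from $[0,1]$ to $[0,1]$. A *$\mathcal{P}$-multipointed $d$-space* $X$ is a space $|X|$ of the chosen category with a subset $X^0$ (the states) and a set of continuous maps $[0,1]\to |X|$ (the execution paths) which start and end in $X^0$ and are closed under precomposition with $\mathcal{P}(1,1)$ and under normalized composition $(\gamma_1*_N\gamma_2)(t)=\gamma_1(2t)$ for $t\le \frac12$, $\gamma_2(2t-1)$ for $t\ge\frac12$, whenever $\gamma_1(1)=\gamma_2(0)$. Maps are continuous maps preserving states and execution paths. The globe $\mathrm{Glob}^{\mathcal{P}}(Z)$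 has as underlying space the quotient of $\{0,1\}\sqcup (Z\times[0,1])$ identifying every $(z,0)$ with $0$ and every $(z,1)$ with $1$, states $\{0,1\}$, and execution paths $t\mapsto (z,\phi(t))$ with $z\in Z$ and $\phi\in\mathcal{P}(1,1)$. A *cellular* $\mathcal{P}$-multipointed $d$-space is one of the form $X_\lambda$ for a tower $(X_\nu)_{\nu\le\lambda}$ indexed by an ordinal $\lambda$, such that $X_0$ is a set (discrete, all points are states, no execution paths), $X_\nu=\varinjlim_{\mu<\nu}X_\mu$ for limit ordinals $\nu\le\lambda$, and for each $\nu<\lambda$ the map $X_\nu\to X_{\nu+1}$ is a pushout of $\mathrm{Glob}^{\mathcal{P}}(\mathbf{S}^{n_\nu-1})\subset \mathrm{Glob}^{\mathcal{P}}(\mathbf{D}^{n_\nu})$ for some $n_\nu\ge 0$ (with $\mathbf{S}^{-1}=\varnothing$). Write $c_\nu$ and $\widehat{c_\nu}$ for the images in $|X_\lambda|$ of $|\mathrm{Glob}^{\mathcal{P}}(\mathbf{D}^{n_\nu})|\setminus|\mathrm{Glob}^{\mathcal{P}}(\mathbf{S}^{n_\nu-1})|$ and of $|\mathrm{Glob}^{\mathcal{P}}(\mathbf{D}^{n_\nu})|$.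 It is *locally finite* if for every $\nu<\lambda$ the set $\{\nu'<\lambda : \widehat{c_{\nu'}}\cap c_\nu\ne\varnothing\}$ is finite and each state belongs to finitely many $\widehat{c_{\nu'}}$. For states $\alpha,\beta$ let $\mathbb{P}^{top}_{\alpha,\beta}X_\lambda$ be the set of execution paths from $\alpha$ to $\beta$ with the $\Delta$-kelleyfication of the relative topology induced by the inclusion in $\mathbf{TOP}([0,1],|X_\lambda|)$ (the set of continuous maps with the $\Delta$-kelleyfication of the compact-open topology), and let $(\mathbb{P}^{top}_{\alpha,\beta}X_\lambda)_{co}$ be the same set with the compact-open topology. Let $\mathbb{P}^{top}X_\lambda=\coprod_{(\alpha,\beta)\in X^0\times X^0}\mathbb{P}^{top}_{\alpha,\beta}X_\lambda$. **Theorem.** Let $X_\lambda$ be a locally finite cellular $\mathcal{P}$-multipointed $d$-space. 1. For all states $\alpha,\beta\in X^0$, the space $(\mathbb{P}^{top}_{\alpha,\beta}X_\lambda)_{co}$ is $\Delta$-generated. 2. The space $\mathbb{P}^{top}X_\lambda$ is metrizable with the distance of the uniform convergence: the space $|X_\lambda|$ is metrizable, and for every metric $d$ inducing the topology of $|X_\lambda|$,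 the formula $D(\gamma_1,\gamma_2)=\sup_{t\in[0,1]}d(\gamma_1(t),\gamma_2(t))$ defines a metric on the set of all execution paths which induces the topology of $\mathbb{P}^{top}X_\lambda$. 3. The topology of $\mathbb{P}^{top}X_\lambda$ is the compact-open topology. -/

import Mathlib

open CategoryTheory TopologicalSpace Topology
open scoped unitInterval

universe u

/-- The two reparametrization categories: `G` (nondecreasing homeomorphisms) and `M`
(nondecreasing surjective maps). -/
inductive Reparam where
  | G
  | M

/-- The set of reparametrizations of length one, `𝒢(1,1)` or `ℳ(1,1)`. -/
def Reparam.maps : Reparam → Set C(I, I)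
  | .G => {φ | Monotone φ ∧ IsHomeomorph φ}
  | .M => {φ | Monotone φ ∧ Function.Surjective φ}

lemma Reparam.comp_mem (P : Reparam) {φ ψ : C(I, I)} (hφ : φ ∈ P.maps) (hψ : ψ ∈ P.maps) :
    φ.comp ψ ∈ P.maps := by
  cases P
  · exact ⟨hφ.1.comp hψ.1, hφ.2.comp hψ.2⟩
  · exact ⟨hφ.1.comp hψ.1, hφ.2.comp hψ.2⟩

lemma Reparam.surjective (P : Reparam) {φ : C(I, I)} (hφ : φ ∈ P.maps) :
    Function.Surjective φ := by
  cases P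
  · exact hφ.2.bijective.surjective
  · exact hφ.2

lemma Reparam.monotone (P : Reparam) {φ : C(I, I)} (hφ : φ ∈ P.maps) : Monotone φ := by
  cases P
  · exact hφ.1
  · exact hφ.1

lemma Reparam.map_zero (P : Reparam) {φ : C(I, I)} (hφ : φ ∈ P.maps) : φ 0 = 0 := by
  obtain ⟨t, ht⟩ := P.surjective hφ 0
  have h : φ 0 ≤ φ t := P.monotone hφ unitInterval.nonneg'
  rw [ht] at h
  exact le_antisymm h unitInterval.nonneg'

lemma Reparam.map_one (P : Reparam) {φ : C(I, I)} (hφ : φ ∈ P.maps) : φ 1 = 1 := by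
  obtain ⟨t, ht⟩ := P.surjective hφ 1
  have h : φ t ≤ φ 1 := P.monotone hφ unitInterval.le_one'
  rw [ht] at h
  exact le_antisymm unitInterval.le_one' h

/-- The normalized composition of two composable continuous paths: `γ₁` is run on `[0, 1/2]` and
`γ₂` on `[1/2, 1]`, both at double speed. -/
noncomputable def normalizedComp {U : Type*} [TopologicalSpace U] (γ₁ γ₂ : C(I, U))
    (h : γ₁ 1 = γ₂ 0) : C(I, U) :=
  ((Path.mk γ₁ rfl h).trans (Path.mk γ₂ rfl rfl)).toContinuousMap

/-- A space is Δ-Hausdorff if the image of every continuous map from `[0,1]` is closed. -/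
def DeltaHausdorff (U : Type*) [TopologicalSpace U] : Prop :=
  ∀ f : C(I, U), IsClosed (Set.range f)

/-- The two possible choices for the category of spaces to work in: Δ-generated spaces or
Δ-Hausdorff Δ-generated spaces. -/
inductive Ambient where
  | deltaGenerated
  | deltaHausdorff

/-- Membership of a space in the chosen category of spaces. -/
def Ambient.Mem : Ambient → (U : Type u) → [TopologicalSpace U] → Prop
  | .deltaGenerated, U, _ => DeltaGeneratedSpace U
  | .deltaHausdorff, U, _ => DeltaGeneratedSpace U ∧ DeltaHausdorff U

/-- A `P`-multipointed d-space: a space, a set of states and a set of execution paths. -/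
structure MDSpace (T : Ambient) (P : Reparam) where
  carrier : Type u
  [top : TopologicalSpace carrier]
  mem : T.Mem carrier
  states : Set carrier
  paths : Set C(I, carrier)
  zero_mem : ∀ γ ∈ paths, γ 0 ∈ states
  one_mem : ∀ γ ∈ paths, γ 1 ∈ states
  reparam_mem : ∀ γ ∈ paths, ∀ φ ∈ P.maps, γ.comp φ ∈ paths
  comp_mem : ∀ γ₁ ∈ paths, ∀ γ₂ ∈ paths, ∀ h : γ₁ 1 = γ₂ 0, normalizedComp γ₁ γ₂ h ∈ paths

namespace MDSpace

variable {T : Ambient} {P : Reparam}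

instance : CoeSort (MDSpace.{u} T P) (Type u) := ⟨carrier⟩

attribute [instance] MDSpace.top

/-- Maps of `P`-multipointed d-spaces. -/
@[ext]
structure Hom (X Y : MDSpace.{u} T P) where
  toMap : C(X, Y)
  map_states : ∀ x ∈ X.states, toMap x ∈ Y.states
  map_paths : ∀ γ ∈ X.paths, toMap.comp γ ∈ Y.paths

instance : Category (MDSpace.{u} T P) where
  Hom X Y := Hom X Y
  id X := ⟨ContinuousMap.id X, fun _ hx => hx, fun _ hγ => hγ⟩
  comp f g := ⟨g.toMap.comp f.toMap, fun x hx => g.map_states _ (f.map_states x hx),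
    fun γ hγ => g.map_paths _ (f.map_paths γ hγ)⟩

/-- The set of execution paths from `α` to `β`. -/
def ExecPath (X : MDSpace.{u} T P) (α β : X) : Type u :=
  {γ : C(I, X) // γ ∈ X.paths ∧ γ 0 = α ∧ γ 1 = β}

/-- The compact-open topology on the set of execution paths from `α` to `β`. -/
abbrev execCoTopology (X : MDSpace.{u} T P) (α β : X) : TopologicalSpace (X.ExecPath α β) :=
  TopologicalSpace.induced Subtype.val ContinuousMap.compactOpen

/-- The standard topology on the set of execution paths from `α` to `β`: the Δ-kelleyfication of
the relative topology induced by the inclusion in the internal hom from `[0,1]` to `X`, which is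
itself the Δ-kelleyfication of the compact-open topology. -/
abbrev execTopology (X : MDSpace.{u} T P) (α β : X) : TopologicalSpace (X.ExecPath α β) :=
  TopologicalSpace.generatedBy (fun n ↦ Fin n → ℝ)
    (tY := TopologicalSpace.induced Subtype.val
      (TopologicalSpace.generatedBy (fun n ↦ Fin n → ℝ) (Y := C(I, X))))

/-- The coproduct of the sets of execution paths from `α` to `β` over all pairs of states. -/
def AllExecPath (X : MDSpace.{u} T P) : Type u :=
  Σ p : X.states × X.states, X.ExecPath p.1 p.2

/-- The underlying continuous path of an execution path. -/
def AllExecPath.toPath {X : MDSpace.{u} T P} (γ : X.AllExecPath) : C(I, X) := γ.2.1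

/-- The space of all execution paths, as the coproduct of the spaces of execution paths from `α`
to `β` over all pairs of states. -/
abbrev allExecTopology (X : MDSpace.{u} T P) : TopologicalSpace X.AllExecPath :=
  @instTopologicalSpaceSigma _ _ (fun p : X.states × X.states => X.execTopology p.1 p.2)

/-- The compact-open topology on the set of all execution paths. -/
abbrev allExecCoTopology (X : MDSpace.{u} T P) : TopologicalSpace X.AllExecPath :=
  TopologicalSpace.induced AllExecPath.toPath ContinuousMap.compactOpen

end MDSpace

/-- The identifications defining the underlying space of a topological globe: `Z × {0}` is
collapsed to the state `0` (here `false`) and `Z × {1}` to the state `1` (here `true`). -/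
inductive GlobRel (Z : Type u) : Bool ⊕ Z × I → Bool ⊕ Z × I → Prop
  | zero (z : Z) : GlobRel Z (Sum.inr (z, 0)) (Sum.inl false)
  | one (z : Z) : GlobRel Z (Sum.inr (z, 1)) (Sum.inl true)

/-- The underlying space of the topological globe of `Z`, with the quotient topology. -/
def GlobSpace (Z : Type u) [TopologicalSpace Z] : Type u := Quot (GlobRel Z)

namespace GlobSpace

variable {Z W : Type u} [TopologicalSpace Z] [TopologicalSpace W]

instance : TopologicalSpace (GlobSpace Z) := inferInstanceAs (TopologicalSpace (Quot (GlobRel Z)))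

/-- The initial (`false`) and final (`true`) states of the globe. -/
def state (b : Bool) : GlobSpace Z := Quot.mk _ (Sum.inl b)

/-- The class of `(z, t)` in the globe. -/
def point (z : Z) (t : I) : GlobSpace Z := Quot.mk _ (Sum.inr (z, t))

lemma point_zero (z : Z) : point z 0 = state false := Quot.sound (GlobRel.zero z)

lemma point_one (z : Z) : point z 1 = state true := Quot.sound (GlobRel.one z)

lemma continuous_point : Continuous fun p : Z × I => (point p.1 p.2 : GlobSpace Z) :=
  continuous_quot_mk.comp continuous_inr

/-- A map out of the globe given by the images of the two states and of the points `(z, t)`. -/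
def desc {V : Type*} (a : Bool → V) (f : Z → I → V) (h₀ : ∀ z, f z 0 = a false)
    (h₁ : ∀ z, f z 1 = a true) : GlobSpace Z → V :=
  Quot.lift (Sum.elim a fun p => f p.1 p.2) (by rintro _ _ (z | z); exacts [h₀ z, h₁ z])

lemma continuous_desc {V : Type*} [TopologicalSpace V] {a : Bool → V} {f : Z → I → V}
    {h₀ : ∀ z, f z 0 = a false} {h₁ : ∀ z, f z 1 = a true}
    (hf : Continuous fun p : Z × I => f p.1 p.2) : Continuous (desc a f h₀ h₁) :=
  continuous_quot_lift _ (continuous_sum_dom.2 ⟨continuous_of_discreteTopology, hf⟩)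

/-- The path `δ_z : t ↦ (z, t)`. -/
def delta (z : Z) : C(I, GlobSpace Z) :=
  ⟨fun t => point z t, continuous_point.comp (Continuous.prodMk_right z)⟩

/-- The map of globes induced by a continuous map. -/
def map (f : C(Z, W)) : C(GlobSpace Z, GlobSpace W) :=
  ⟨desc state (fun z t => point (f z) t) (fun z => point_zero (f z)) (fun z => point_one (f z)),
    continuous_desc (continuous_point.comp
      (Continuous.prodMk (f.continuous.comp continuous_fst) continuous_snd))⟩

/-- The projection of the globe on `[0,1]`. -/
def height : GlobSpace Z → I :=
  desc (fun b => if b then 1 else 0) (fun _ t => t) (fun _ => rfl) (fun _ => rfl)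

lemma continuous_height : Continuous (height : GlobSpace Z → I) := continuous_desc continuous_snd

lemma state_true_ne_state_false : (state true : GlobSpace Z) ≠ state false := by
  intro h
  have h' : height (state true : GlobSpace Z) = height (state false : GlobSpace Z) :=
    congrArg height h
  exact one_ne_zero (α := I) h'

instance t2Space {E : Type u} [NormedAddCommGroup E] [NormedSpace ℝ E] (S : Set E) :
    T2Space (GlobSpace S) := by
  let k : GlobSpace S → E :=
    desc (fun _ => 0) (fun z t => ((t : ℝ) * (1 - t)) • (z : E)) (by simp) (by simp)
  have hk : Continuous k := continuous_desc (by fun_prop)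
  refine T2Space.of_injective_continuous (f := fun x => (height x, k x)) ?_
    (continuous_height.prodMk hk)
  have key : ∀ x : GlobSpace S, (∃ b, x = state b ∧ height x = if b then 1 else 0) ∨
      ∃ z t, x = point z t ∧ height x = t ∧ k x = ((t : ℝ) * (1 - t)) • (z : E) ∧
        t ≠ 0 ∧ t ≠ 1 := by
    rintro ⟨b | ⟨z, t⟩⟩
    · exact Or.inl ⟨b, rfl, rfl⟩
    · by_cases h0 : t = 0
      · subst h0; exact Or.inl ⟨false, point_zero z, rfl⟩
      by_cases h1 : t = 1
      · subst h1; exact Or.inl ⟨true, point_one z, rfl⟩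
      exact Or.inr ⟨z, t, rfl, rfl, rfl, h0, h1⟩
  intro x y hxy
  obtain ⟨hh, hkk⟩ := Prod.mk.inj hxy
  obtain ⟨b, rfl, hb⟩ | ⟨z, t, rfl, hz, kz, z0, z1⟩ := key x <;>
  obtain ⟨c, rfl, hc⟩ | ⟨w, s, rfl, hw, kw, w0, w1⟩ := key y
  · rw [hb, hc] at hh
    cases b <;> cases c <;> simp_all
  · rw [hb, hw] at hh
    cases b <;> simp_all
  · rw [hz, hc] at hh
    cases c <;> simp_all
  · rw [hz, hw] at hh
    subst hh
    rw [kz, kw] at hkk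
    have h1 : (t : ℝ) * (1 - t) ≠ 0 := by
      refine mul_ne_zero (fun h => z0 (Subtype.ext h)) (fun h => z1 (Subtype.ext ?_))
      simpa using (sub_eq_zero.1 h).symm
    rw [Subtype.ext (smul_right_injective E h1 hkk)]

end GlobSpace

/-- A retract of an open subset of a finite-dimensional normed space is Δ-generated. -/
lemma deltaGenerated_of_retract {E : Type*} [NormedAddCommGroup E] [NormedSpace ℝ E]
    [FiniteDimensional ℝ E] {Z : Type*} [TopologicalSpace Z] {U : Set E} (hU : IsOpen U)
    {s : Z → U} {r : U → Z} (hs : Continuous s) (hr : Continuous r)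
    (h : Function.LeftInverse r s) : DeltaGeneratedSpace Z := by
  have e : (Fin (Module.finrank ℝ E) → ℝ) ≃L[ℝ] E :=
    ContinuousLinearEquiv.ofFinrankEq (by simp)
  have hE : DeltaGeneratedSpace E := e.toHomeomorph.isQuotientMap.isGeneratedBy
  have hDU : DeltaGeneratedSpace U := by
    refine Topology.IsGeneratedBy.iff_le_generatedBy.2 fun A hA => ?_
    refine isOpen_iff_mem_nhds.2 fun x hx => ?_
    obtain ⟨ε, hε, hball⟩ := Metric.isOpen_iff.1 hU x x.2
    let B := OpenPartialHomeomorph.univBall (x : E) ε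
    have hB : ∀ y, B y ∈ U := fun y => hball (by
      rw [← OpenPartialHomeomorph.univBall_target (x : E) hε]
      exact B.map_source (by simp [B]))
    let f : E → U := fun y => ⟨B y, hB y⟩
    have hBc : Continuous B := OpenPartialHomeomorph.continuous_univBall (x : E) ε
    have hf : Continuous f := hBc.subtype_mk _
    have hfo : IsOpenMap f := by
      have : IsOpenMap B := by
        intro V hV
        exact B.isOpen_image_of_subset_source hV (by simp [B])
      intro V hV
      have h2 : f '' V = Subtype.val ⁻¹' (B '' V) := by
        ext y
        constructor
        · rintro ⟨v, hv, rfl⟩; exact ⟨v, hv, rfl⟩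
        · rintro ⟨v, hv, hvy⟩; exact ⟨v, hv, Subtype.ext hvy⟩
      rw [h2]
      exact (this V hV).preimage continuous_subtype_val
    have hpre : IsOpen (f ⁻¹' A) := by
      refine (Topology.IsGeneratedBy.isOpen_iff (fun n ↦ Fin n → ℝ)).2 fun n g => ?_
      exact (Topology.WithGeneratedByTopology.isOpen_iff
        (X := fun n ↦ Fin n → ℝ) (Y := U) (U := A)).1 hA (i := n)
        ((⟨f, hf⟩ : C(E, U)).comp g)
    have hx0 : f 0 = x := Subtype.ext (OpenPartialHomeomorph.univBall_apply_zero (x : E) ε)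
    refine Filter.mem_of_superset ((hfo _ hpre).mem_nhds ⟨0, ?_, hx0⟩) (by simp)
    simpa [hx0] using hx
  exact (Topology.IsQuotientMap.of_inverse hs hr h).isGeneratedBy

/-- `ℝⁿ` with the Euclidean norm, in the universe `u`. -/
abbrev Euc (n : ℕ) : Type u := EuclideanSpace ℝ (ULift.{u} (Fin n))

/-- The closed unit disk of `ℝⁿ`. -/
abbrev Disk (n : ℕ) : Set (Euc.{u} n) := Metric.closedBall 0 1

/-- The unit sphere of `ℝⁿ`, empty for `n = 0`. -/
abbrev Sphere (n : ℕ) : Set (Euc.{u} n) := Metric.sphere 0 1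

lemma globSpace_mem_of_retract (T : Ambient) {E : Type u} [NormedAddCommGroup E]
    [NormedSpace ℝ E] [FiniteDimensional ℝ E] {S U : Set E} (hU : IsOpen U) (hSU : S ⊆ U)
    (r : U → S) (hr : Continuous r) (h : ∀ x : S, r ⟨x, hSU x.2⟩ = x) :
    T.Mem (GlobSpace S) := by
  have hprod : DeltaGeneratedSpace (S × I) := by
    have hV : IsOpen {p : E × ℝ | p.1 ∈ U} := hU.preimage continuous_fst
    refine deltaGenerated_of_retract hV
      (s := fun p => ⟨(p.1, p.2), hSU p.1.2⟩)
      (r := fun p => (r ⟨p.1.1, p.2⟩, Set.projIcc 0 1 zero_le_one p.1.2)) ?_ ?_ ?_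
    · fun_prop
    · refine (hr.comp ?_).prodMk ?_
      · fun_prop
      · exact continuous_projIcc.comp (by fun_prop)
    · intro p
      exact Prod.ext (h p.1) (Set.projIcc_val zero_le_one p.2)
  have hBool : DeltaGeneratedSpace Bool := by
    refine Topology.IsGeneratedBy.iff_le_generatedBy.2 ?_
    rw [DiscreteTopology.eq_bot (α := Bool)]
    exact bot_le
  have h1 : DeltaGeneratedSpace (GlobSpace S) :=
    inferInstanceAs (DeltaGeneratedSpace (Quot (GlobRel S)))
  cases T
  · exact h1
  · exact ⟨h1, fun f => (isCompact_range f.continuous).isClosed⟩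

lemma globSpace_disk_mem (T : Ambient) (n : ℕ) : T.Mem (GlobSpace (Disk.{u} n)) := by
  refine globSpace_mem_of_retract T isOpen_univ (Set.subset_univ _)
    (fun x => ⟨(max 1 ‖(x : Euc.{u} n)‖)⁻¹ • (x : Euc.{u} n), ?_⟩) ?_ ?_
  · have : (0 : ℝ) < max 1 ‖(x : Euc.{u} n)‖ := lt_max_of_lt_left one_pos
    rw [mem_closedBall_zero_iff, norm_smul, norm_inv, Real.norm_of_nonneg this.le,
      inv_mul_le_iff₀ this, mul_one]
    exact le_max_right _ _
  · refine Continuous.subtype_mk (Continuous.smul (Continuous.inv₀ (continuous_const.max continuous_subtype_val.norm) ?_)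
      continuous_subtype_val) _
    intro x
    exact (lt_max_of_lt_left one_pos).ne'
  · intro x
    have : ‖(x : Euc.{u} n)‖ ≤ 1 := mem_closedBall_zero_iff.1 x.2
    exact Subtype.ext (by simp [max_eq_left this])

lemma globSpace_sphere_mem (T : Ambient) (n : ℕ) : T.Mem (GlobSpace (Sphere.{u} n)) := by
  have h0 : ∀ x : ({0}ᶜ : Set (Euc.{u} n)), ‖(x : Euc.{u} n)‖ ≠ 0 := fun x => norm_ne_zero_iff.2 x.2
  refine globSpace_mem_of_retract T (isOpen_compl_singleton (x := 0)) ?_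
    (fun x => ⟨‖(x : Euc.{u} n)‖⁻¹ • (x : Euc.{u} n), ?_⟩) ?_ ?_
  · rintro x hx rfl
    simp at hx
  · simp [norm_smul, h0 x]
  · exact Continuous.subtype_mk (Continuous.smul (Continuous.inv₀ continuous_subtype_val.norm h0)
      continuous_subtype_val) _
  · intro x
    have : ‖(x : Euc.{u} n)‖ = 1 := mem_sphere_zero_iff_norm.1 x.2
    exact Subtype.ext (by simp [this])

/-- The topological globe of `Z`: its states are `0` and `1` and its execution paths are the
`δ_z φ` for `z` in `Z` and `φ` in `P(1,1)`. -/
def Glob (T : Ambient) (P : Reparam) (Z : Type u) [TopologicalSpace Z] (hZ : T.Mem (GlobSpace Z)) :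
    MDSpace.{u} T P where
  carrier := GlobSpace Z
  mem := hZ
  states := Set.range GlobSpace.state
  paths := {γ | ∃ z : Z, ∃ φ ∈ P.maps, γ = (GlobSpace.delta z).comp φ}
  zero_mem := by
    rintro _ ⟨z, φ, hφ, rfl⟩
    refine ⟨false, ?_⟩
    simp [P.map_zero hφ, GlobSpace.delta, GlobSpace.point_zero]
  one_mem := by
    rintro _ ⟨z, φ, hφ, rfl⟩
    refine ⟨true, ?_⟩
    simp [P.map_one hφ, GlobSpace.delta, GlobSpace.point_one]
  reparam_mem := by
    rintro _ ⟨z, φ, hφ, rfl⟩ ψ hψ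
    exact ⟨z, φ.comp ψ, P.comp_mem hφ hψ, rfl⟩
  comp_mem := by
    rintro _ ⟨z, φ, hφ, rfl⟩ _ ⟨w, ψ, hψ, rfl⟩ h
    refine absurd ?_ (GlobSpace.state_true_ne_state_false (Z := Z))
    simpa [P.map_one hφ, P.map_zero hψ, GlobSpace.delta, GlobSpace.point_zero,
      GlobSpace.point_one] using h

/-- The globe of the `n`-dimensional disk. -/
def globDisk (T : Ambient) (P : Reparam) (n : ℕ) : MDSpace.{u} T P :=
  Glob T P (Disk.{u} n) (globSpace_disk_mem T n)

/-- The globe of the `(n-1)`-dimensional sphere. -/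
def globSphere (T : Ambient) (P : Reparam) (n : ℕ) : MDSpace.{u} T P :=
  Glob T P (Sphere.{u} n) (globSpace_sphere_mem T n)

/-- The inclusion of the unit sphere in the closed unit disk. -/
def sphereToDisk (n : ℕ) : C(Sphere.{u} n, Disk.{u} n) :=
  ⟨Set.inclusion Metric.sphere_subset_closedBall, continuous_inclusion _⟩

/-- The map of globes induced by the inclusion of the sphere in the disk. -/
def globIncl (T : Ambient) (P : Reparam) (n : ℕ) : globSphere.{u} T P n ⟶ globDisk.{u} T P n :=
  MDSpace.Hom.mk (GlobSpace.map (sphereToDisk n))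
    (by rintro _ ⟨b, rfl⟩; exact ⟨b, rfl⟩)
    (by rintro _ ⟨z, φ, hφ, rfl⟩; exact ⟨sphereToDisk n z, φ, hφ, rfl⟩)

namespace Stage

variable {lam : Ordinal.{u}}

/-- The ordinal `0` in `{ν | ν ≤ lam}`. -/
def zero (lam : Ordinal.{u}) : Set.Iic lam := ⟨0, Set.mem_Iic.2 zero_le⟩

/-- The ordinal `lam` in `{ν | ν ≤ lam}`. -/
def last (lam : Ordinal.{u}) : Set.Iic lam := ⟨lam, Set.mem_Iic.2 le_rfl⟩

/-- An ordinal `ν < lam`, in `{ν | ν ≤ lam}`. -/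
def of (ν : Set.Iio lam) : Set.Iic lam := ⟨ν.1, Set.mem_Iic.2 (le_of_lt ν.2)⟩

/-- The successor of an ordinal `ν < lam`, in `{ν | ν ≤ lam}`. -/
def next (ν : Set.Iio lam) : Set.Iic lam :=
  ⟨Order.succ ν.1, Set.mem_Iic.2 (Order.succ_le_of_lt ν.2)⟩

lemma of_le_next (ν : Set.Iio lam) : of ν ≤ next ν := Order.le_succ ν.1

lemma le_last (ν : Set.Iic lam) : ν ≤ last lam := ν.2

end Stage

/-- A cellular `P`-multipointed d-space, presented by a tower `(X_ν)_{ν ≤ λ}` indexed by an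
ordinal `λ` which is continuous at limit ordinals, which starts from a set, and in which
`X_{ν+1}` is obtained from `X_ν` by attaching a globe of a disk along the globe of its boundary. -/
structure CellularMDSpace (T : Ambient) (P : Reparam) where
  lam : Ordinal.{u}
  tower : Set.Iic lam ⥤ MDSpace.{u} T P
  continuous : tower.IsWellOrderContinuous
  zero_discrete : DiscreteTopology (tower.obj (Stage.zero lam))
  zero_states : (tower.obj (Stage.zero lam)).states = Set.univ
  zero_paths : (tower.obj (Stage.zero lam)).paths = ∅
  dim : Set.Iio lam → ℕ
  attach : ∀ ν : Set.Iio lam, globSphere T P (dim ν) ⟶ tower.obj (Stage.of ν)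
  char : ∀ ν : Set.Iio lam,
    globDisk T P (dim ν) ⟶ tower.obj (Stage.next ν)
  isPushout : ∀ ν : Set.Iio lam, IsPushout (attach ν) (globIncl T P (dim ν))
    (tower.map (homOfLE (Stage.of_le_next ν))) (char ν)

namespace CellularMDSpace

variable {T : Ambient} {P : Reparam}

/-- The `P`-multipointed d-space `X_λ`. -/
def total (X : CellularMDSpace.{u} T P) : MDSpace.{u} T P := X.tower.obj (Stage.last X.lam)

/-- The map from the globe of the disk to `X_λ` belonging to the cell `ν`. -/
def cellMap (X : CellularMDSpace.{u} T P) (ν : Set.Iio X.lam) :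
    globDisk T P (X.dim ν) ⟶ X.total :=
  X.char ν ≫ X.tower.map (homOfLE (Stage.le_last _))

/-- The globular cell `c_ν` in `X_λ`: the image of the complement of the globe of the sphere in
the globe of the disk. -/
def openCell (X : CellularMDSpace.{u} T P) (ν : Set.Iio X.lam) : Set X.total :=
  (X.cellMap ν).toMap '' (Set.range (globIncl T P (X.dim ν)).toMap)ᶜ

/-- The closed globular cell in `X_λ`: the image of the globe of the disk. -/
def closedCell (X : CellularMDSpace.{u} T P) (ν : Set.Iio X.lam) : Set X.total :=
  Set.range (X.cellMap ν).toMap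

/-- Every globular cell meets finitely many closed globular cells and every state belongs to
finitely many closed globular cells. -/
structure LocallyFinite (X : CellularMDSpace.{u} T P) : Prop where
  cell : ∀ ν : Set.Iio X.lam, {ν' | (X.closedCell ν' ∩ X.openCell ν).Nonempty}.Finite
  state : ∀ α ∈ X.total.states, {ν' | α ∈ X.closedCell ν'}.Finite

end CellularMDSpace

/-! ### Colimits of multipointed d-spaces -/

namespace MDSpace

variable {T : Ambient} {P : Reparam}

/-! The core is a lifting statement for sequences: if execution paths with fixed endpoints converge
in the compact-open topology, then infinitely many of them lie on a continuous path `H` of maps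
whose value at `0` is the limit and whose other values are execution paths
(`LocallyFinite.exists_path_of_tendsto`). Since the underlying space is metrizable, the compact-open
topology is first countable, so closedness can be tested on sequences; when the limit is itself an
execution path, `H` turns the sequence into a probe from an interval, and the compact-open topology
is Δ-generated. Both Δ-kelleyfications in `execTopology` are then superfluous. The states form a
closed discrete set, so the coproduct over pairs of states also carries the compact-open topology,
which is that of uniform convergence.

Geometry of the space. Real functions extend from each stage of the tower to the whole space
(Tietze, pushouts, transfinite composition), which makes it Hausdorff and the cells disjoint and
injectively parametrized. A set meeting each open cell at most once is closed, hence a compact set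
meets finitely many open cells; local finiteness upgrades this to closed cells. The closed cells and
the states form a locally finite cover by second countable compacta, whence metrizability.

The lifting statement. Every execution path is `c ∘ φ` with `c` a bracketed composite of cell paths
and `φ` a reparametrization. Each cell path leaves the states, so compactness of the disk bounds its
displacement from below; with the equicontinuity of a convergent sequence this bounds the number of
factors, and only finitely many cells occur. Hence infinitely many terms share one bracketed word
(`LocallyFinite.exists_frequently_isComposite`). The composites of a given word are parametrized by
a compact convex set, and reparametrizations form a convex set, so consecutive terms can be joined
by linear interpolation. The reparametrizations converge only at rational times and their limit may
jump, but the limit composite is constant across each jump (`eq_of_tendsto_reparametrized`), so the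
interpolation extends continuously to the limit. -/

lemma normalizedComp_comp {U V : Type*} [TopologicalSpace U] [TopologicalSpace V] (f : C(U, V))
    (γ₁ γ₂ : C(I, U)) (h : γ₁ 1 = γ₂ 0) (h' : (f.comp γ₁) 1 = (f.comp γ₂) 0) :
    f.comp (normalizedComp γ₁ γ₂ h) = normalizedComp (f.comp γ₁) (f.comp γ₂) h' := by
  ext t
  change f ((Path.trans _ _) t) = (Path.trans _ _) t
  simp only [Path.trans_apply]
  split_ifs <;> rfl

lemma normalizedComp_zero {U : Type*} [TopologicalSpace U]
    (γ₁ γ₂ : C(I, U)) (h : γ₁ 1 = γ₂ 0) : normalizedComp γ₁ γ₂ h 0 = γ₁ 0 :=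
  Path.source _

lemma normalizedComp_one {U : Type*} [TopologicalSpace U]
    (γ₁ γ₂ : C(I, U)) (h : γ₁ 1 = γ₂ 0) : normalizedComp γ₁ γ₂ h 1 = γ₂ 1 :=
  Path.target _

@[simp] lemma comp_toMap {X Y Z : MDSpace.{u} T P} (f : X ⟶ Y) (g : Y ⟶ Z) :
    (f ≫ g).toMap = g.toMap.comp f.toMap := rfl

lemma hom_ext_apply {X Y : MDSpace.{u} T P} {f g : X ⟶ Y} (h : ∀ x, f.toMap x = g.toMap x) :
    f = g :=
  Hom.ext (ContinuousMap.ext h)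

lemma hom_congr {X Y : MDSpace.{u} T P} {f g : X ⟶ Y} (h : f = g) (x : X) :
    f.toMap x = g.toMap x := by rw [h]

lemma deltaGenerated (X : MDSpace.{u} T P) : DeltaGeneratedSpace X := by
  cases T
  · exact X.mem
  · exact X.mem.1

/-- Under a continuous injection the image of a path is the preimage of the image of the composed
path, so Δ-Hausdorffness passes to the source. This keeps `ColimitImage` in the chosen category. -/
lemma mem_of_injective {Y : MDSpace.{u} T P} {A : Type u} [TopologicalSpace A]
    (hA : DeltaGeneratedSpace A) {f : A → Y} (hf : Continuous f) (hi : Function.Injective f) :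
    T.Mem A := by
  cases T
  · exact hA
  · refine ⟨hA, fun g => ?_⟩
    have h := (Y.mem.2 ((⟨f, hf⟩ : C(A, Y)).comp g)).preimage hf
    convert h using 1
    ext a
    constructor
    · rintro ⟨t, rfl⟩; exact ⟨t, rfl⟩
    · rintro ⟨t, ht⟩; exact ⟨t, hi ht⟩

section Colimit

open Limits

variable {J : Type*} [Category J] {F : J ⥤ MDSpace.{u} T P} (c : Cocone F)

/-- The union of the images of a diagram in a cocone. -/
def ColimitImage : Type u := {x : c.pt // ∃ j y, (c.ι.app j).toMap y = x}

/-- The map from an object of the diagram to the union of the images. -/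
def ColimitImage.incl (j : J) (y : F.obj j) : ColimitImage c :=
  ⟨(c.ι.app j).toMap y, j, y, rfl⟩

/-- The final topology on the union of the images. -/
instance : TopologicalSpace (ColimitImage c) :=
  ⨆ j, TopologicalSpace.coinduced (ColimitImage.incl c j) inferInstance

lemma ColimitImage.continuous_incl (j : J) : Continuous (ColimitImage.incl c j) :=
  continuous_iff_coinduced_le.2 (le_iSup
    (fun j => TopologicalSpace.coinduced (ColimitImage.incl c j) inferInstance) j)

lemma ColimitImage.continuous_val : Continuous (fun x : ColimitImage c => x.1) :=
  continuous_iSup_dom.2 fun j => continuous_coinduced_dom.2 (c.ι.app j).toMap.continuous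

/-- The inclusion of the union of the images, as a continuous map. -/
def ColimitImage.val : C(ColimitImage c, c.pt) := ⟨_, ColimitImage.continuous_val c⟩

lemma ColimitImage.deltaGenerated : DeltaGeneratedSpace (ColimitImage c) :=
  IsGeneratedBy.iSup fun j => (letI := (F.obj j).deltaGenerated; IsGeneratedBy.coinduced _)

/-- The union of the images of a diagram in a cocone, as a multipointed d-space with a given set
of allowed execution paths. -/
def colimitImage (S : Set C(I, c.pt)) (hr : ∀ γ ∈ S, ∀ φ ∈ P.maps, γ.comp φ ∈ S)
    (hc : ∀ γ₁ ∈ S, ∀ γ₂ ∈ S, ∀ h : γ₁ 1 = γ₂ 0, normalizedComp γ₁ γ₂ h ∈ S) :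
    MDSpace.{u} T P where
  carrier := ColimitImage c
  mem := mem_of_injective (ColimitImage.deltaGenerated c) (ColimitImage.continuous_val c)
    Subtype.val_injective
  states := {x | ∃ j, ∃ y ∈ (F.obj j).states, ColimitImage.incl c j y = x}
  -- Lying in `c.pt.paths` only makes the endpoints states of `c.pt`; that these come from states of
  -- the diagram is known only after `exists_section`, so it is imposed here.
  paths := {γ | ((ColimitImage.val c).comp γ ∈ S ∧ (ColimitImage.val c).comp γ ∈ c.pt.paths) ∧
    (∃ j, ∃ y ∈ (F.obj j).states, ColimitImage.incl c j y = γ 0) ∧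
    (∃ j, ∃ y ∈ (F.obj j).states, ColimitImage.incl c j y = γ 1)}
  zero_mem := fun γ h => h.2.1
  one_mem := fun γ h => h.2.2
  reparam_mem := by
    rintro γ ⟨⟨h1, h2⟩, h3, h4⟩ φ hφ
    refine ⟨⟨hr _ h1 φ hφ, c.pt.reparam_mem _ h2 φ hφ⟩, ?_, ?_⟩
    · simpa [P.map_zero hφ] using h3
    · simpa [P.map_one hφ] using h4
  comp_mem := by
    rintro γ₁ ⟨⟨h1, h2⟩, h3, h4⟩ γ₂ ⟨⟨h1', h2'⟩, h3', h4'⟩ h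
    have h' : ((ColimitImage.val c).comp γ₁) 1 = ((ColimitImage.val c).comp γ₂) 0 :=
      congrArg (ColimitImage.val c) h
    refine ⟨?_, ?_, ?_⟩
    · rw [normalizedComp_comp _ _ _ h h']
      exact ⟨hc _ h1 _ h1' h', c.pt.comp_mem _ h2 _ h2' h'⟩
    · rw [normalizedComp_zero]; exact h3
    · rw [normalizedComp_one]; exact h4'

variable {c}

/-- Nothing is constructed about colimits: the union of the images, with the final topology and only
the paths in `S`, receives the diagram, and uniqueness in the universal property makes it a retract
of `c.pt` over its inclusion. Points, closed sets, states and paths of a colimit are all read off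
from this section. -/
lemma exists_section (hc : IsColimit c) (S : Set C(I, c.pt))
    (hr : ∀ γ ∈ S, ∀ φ ∈ P.maps, γ.comp φ ∈ S)
    (hs : ∀ γ₁ ∈ S, ∀ γ₂ ∈ S, ∀ h : γ₁ 1 = γ₂ 0, normalizedComp γ₁ γ₂ h ∈ S)
    (hF : ∀ j, ∀ γ ∈ (F.obj j).paths, (c.ι.app j).toMap.comp γ ∈ S) :
    ∃ f : c.pt ⟶ colimitImage c S hr hs, ∀ x, (ColimitImage.val c) (f.toMap x) = x := by
  let t : Cocone F :=
    { pt := colimitImage c S hr hs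
      ι :=
        { app := fun j => Hom.mk ⟨ColimitImage.incl c j, ColimitImage.continuous_incl c j⟩
            (fun x hx => ⟨j, x, hx, rfl⟩)
            (fun γ hγ => ⟨⟨hF j γ hγ, (c.ι.app j).map_paths γ hγ⟩,
              ⟨j, _, (F.obj j).zero_mem γ hγ, rfl⟩, ⟨j, _, (F.obj j).one_mem γ hγ, rfl⟩⟩)
          naturality := fun i j f => by
            refine hom_ext_apply fun x => Subtype.ext ?_
            exact hom_congr (c.w f) x } }
  let i : t.pt ⟶ c.pt := Hom.mk (ColimitImage.val c)
    (by rintro _ ⟨j, y, hy, rfl⟩; exact (c.ι.app j).map_states y hy)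
    (fun γ hγ => hγ.1.2)
  have h : hc.desc t ≫ i = 𝟙 _ := hc.hom_ext fun j => by
    rw [hc.fac_assoc, Category.comp_id]
    rfl
  exact ⟨hc.desc t, fun x => hom_congr h x⟩

lemma IsColimit.exists_eq (hc : IsColimit c) (x : c.pt) : ∃ j y, (c.ι.app j).toMap y = x := by
  obtain ⟨f, hf⟩ := exists_section hc Set.univ (fun _ _ _ _ => trivial)
    (fun _ _ _ _ _ => trivial) (fun _ _ _ => trivial)
  rw [← hf x]
  exact (f.toMap x).2

lemma IsColimit.isClosed (hc : IsColimit c) {A : Set c.pt}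
    (hA : ∀ j, IsClosed ((c.ι.app j).toMap ⁻¹' A)) : IsClosed A := by
  obtain ⟨f, hf⟩ := exists_section hc Set.univ (fun _ _ _ _ => trivial)
    (fun _ _ _ _ _ => trivial) (fun _ _ _ => trivial)
  have h : IsClosed ((ColimitImage.val c) ⁻¹' A) := by
    refine isClosed_iSup_iff.2 fun j => isClosed_coinduced.2 (hA j)
  convert h.preimage f.toMap.continuous using 1
  ext x
  change x ∈ A ↔ (ColimitImage.val c) (f.toMap x) ∈ A
  rw [hf]

lemma IsColimit.exists_state (hc : IsColimit c) {x : c.pt} (hx : x ∈ c.pt.states) :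
    ∃ j, ∃ y ∈ (F.obj j).states, (c.ι.app j).toMap y = x := by
  obtain ⟨f, hf⟩ := exists_section hc Set.univ (fun _ _ _ _ => trivial)
    (fun _ _ _ _ _ => trivial) (fun _ _ _ => trivial)
  obtain ⟨j, y, hy, h⟩ := f.map_states x hx
  refine ⟨j, y, hy, ?_⟩
  rw [← hf x, ← h]
  rfl

/-- The section preserves execution paths, and those of its target lie in `S` by definition. -/
lemma IsColimit.path_induction (hc : IsColimit c) (S : Set C(I, c.pt))
    (hr : ∀ γ ∈ S, ∀ φ ∈ P.maps, γ.comp φ ∈ S)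
    (hs : ∀ γ₁ ∈ S, ∀ γ₂ ∈ S, ∀ h : γ₁ 1 = γ₂ 0, normalizedComp γ₁ γ₂ h ∈ S)
    (hF : ∀ j, ∀ γ ∈ (F.obj j).paths, (c.ι.app j).toMap.comp γ ∈ S) : c.pt.paths ⊆ S := by
  obtain ⟨f, hf⟩ := exists_section hc S hr hs hF
  intro γ hγ
  have h := (f.map_paths γ hγ).1.1
  convert h using 1
  ext t
  exact (hf _).symm

end Colimit

/-! ### The colimit criteria specialised to pushouts. -/

section Pushout

variable {A B X Y : MDSpace.{u} T P} {f : A ⟶ X} {i : A ⟶ B} {j : X ⟶ Y} {g : B ⟶ Y}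

lemma IsPushout.exists_eq (h : IsPushout f i j g) (y : Y) :
    (∃ x, j.toMap x = y) ∨ ∃ b, g.toMap b = y := by
  obtain ⟨k, z, hz⟩ := IsColimit.exists_eq h.isColimit y
  obtain _ | _ | _ := k
  · exact .inl ⟨f.toMap z, (hom_congr (Limits.PushoutCocone.condition_zero h.cocone) z).symm.trans hz⟩
  · exact .inl ⟨z, hz⟩
  · exact .inr ⟨z, hz⟩

lemma IsPushout.isClosed (h : IsPushout f i j g) {S : Set Y} (h1 : IsClosed (j.toMap ⁻¹' S))
    (h2 : IsClosed (g.toMap ⁻¹' S)) : IsClosed S := by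
  refine IsColimit.isClosed h.isColimit ?_
  rintro (_ | _ | _)
  · rw [Limits.PushoutCocone.condition_zero h.cocone]
    exact h1.preimage f.toMap.continuous
  · exact h1
  · exact h2

lemma IsPushout.exists_state (h : IsPushout f i j g) {y : Y} (hy : y ∈ Y.states) :
    (∃ x ∈ X.states, j.toMap x = y) ∨ ∃ b ∈ B.states, g.toMap b = y := by
  obtain ⟨k, z, hk, hz⟩ := IsColimit.exists_state h.isColimit hy
  obtain _ | _ | _ := k
  · exact .inl ⟨f.toMap z, f.map_states z hk,
      (hom_congr (Limits.PushoutCocone.condition_zero h.cocone) z).symm.trans hz⟩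
  · exact .inl ⟨z, hk, hz⟩
  · exact .inr ⟨z, hk, hz⟩

lemma IsPushout.path_induction (h : IsPushout f i j g) (S : Set C(I, Y))
    (hr : ∀ γ ∈ S, ∀ φ ∈ P.maps, γ.comp φ ∈ S)
    (hs : ∀ γ₁ ∈ S, ∀ γ₂ ∈ S, ∀ h : γ₁ 1 = γ₂ 0, normalizedComp γ₁ γ₂ h ∈ S)
    (h1 : ∀ γ ∈ X.paths, j.toMap.comp γ ∈ S) (h2 : ∀ γ ∈ B.paths, g.toMap.comp γ ∈ S) :
    Y.paths ⊆ S := by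
  refine IsColimit.path_induction h.isColimit S hr hs ?_
  rintro (_ | _ | _) γ hγ
  · rw [Limits.PushoutCocone.condition_zero h.cocone]
    exact h1 _ (f.map_paths γ hγ)
  · exact h1 _ hγ
  · exact h2 _ hγ

end Pushout

end MDSpace

/-! ### Continuous functions as maps of multipointed d-spaces -/

namespace MDSpace

/-- A space with all points as states and all paths as execution paths. -/
def chaotic (T : Ambient) (P : Reparam) (A : Type u) [TopologicalSpace A] (h : T.Mem A) :
    MDSpace.{u} T P where
  carrier := A
  mem := h
  states := Set.univ
  paths := Set.univ
  zero_mem _ _ := trivial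
  one_mem _ _ := trivial
  reparam_mem _ _ _ _ := trivial
  comp_mem _ _ _ _ _ := trivial

lemma mem_of_t2 (T : Ambient) (A : Type u) [TopologicalSpace A] [DeltaGeneratedSpace A]
    [T2Space A] : T.Mem A := by
  cases T
  · assumption
  · exact ⟨inferInstance, fun f => (isCompact_range f.continuous).isClosed⟩

instance deltaGenerated_uliftReal : DeltaGeneratedSpace (ULift.{u} ℝ) := by
  have e : (Fin 1 → ℝ) ≃ₜ ULift.{u} ℝ := (Homeomorph.funUnique _ _).trans Homeomorph.ulift.symm
  exact e.isQuotientMap.isGeneratedBy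

/-- The chaotic real line. -/
def line (T : Ambient) (P : Reparam) : MDSpace.{u} T P := chaotic T P (ULift.{u} ℝ) (mem_of_t2 _ _)

/-- The chaotic point. -/
def point (T : Ambient) (P : Reparam) : MDSpace.{u} T P := chaotic T P PUnit (mem_of_t2 _ _)

variable {T : Ambient} {P : Reparam}

/-- The constant map to the chaotic point. -/
def toPoint (X : MDSpace.{u} T P) : X ⟶ point T P :=
  Hom.mk (ContinuousMap.const _ PUnit.unit) (fun _ _ => trivial) (fun _ _ => trivial)

/-- A continuous function as a map to the chaotic real line. -/
def toLine {X : MDSpace.{u} T P} (f : C(X, ℝ)) : X ⟶ line T P :=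
  Hom.mk ⟨fun x => ULift.up (f x), by fun_prop⟩ (fun _ _ => trivial) (fun _ _ => trivial)

/-- The continuous function underlying a map to the chaotic real line. -/
def ofLine {X : MDSpace.{u} T P} (f : X ⟶ line T P) : C(X, ℝ) :=
  ⟨fun x => (f.toMap x : ULift.{u} ℝ).down, continuous_uliftDown.comp f.toMap.continuous⟩

/-- If a continuous function can be extended along `i`, then `i` has the left lifting property
with respect to the projection of the chaotic line. -/
lemma hasLiftingProperty_line {A B : MDSpace.{u} T P} (i : A ⟶ B)
    (h : ∀ f : C(A, ℝ), ∃ g : C(B, ℝ), ∀ x, g (i.toMap x) = f x) :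
    HasLiftingProperty i (toPoint (line T P)) := by
  refine ⟨fun {f g} sq => ?_⟩
  obtain ⟨k, hk⟩ := h (ofLine f)
  refine ⟨⟨⟨toLine k, ?_, ?_⟩⟩⟩
  · exact hom_ext_apply fun x => congrArg ULift.up (hk x)
  · exact hom_ext_apply fun x => rfl

lemma exists_extension_of_hasLiftingProperty {A B : MDSpace.{u} T P} {i : A ⟶ B}
    (h : HasLiftingProperty i (toPoint (line T P))) (f : C(A, ℝ)) :
    ∃ g : C(B, ℝ), ∀ x, g (i.toMap x) = f x := by
  have sq : CommSq (toLine f) i (toPoint (line T P)) (toPoint B) := ⟨rfl⟩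
  exact ⟨ofLine sq.lift, fun x => congrArg ULift.down (hom_congr sq.fac_left x)⟩

lemma IsPushout.exists_extension {A B X Y : MDSpace.{u} T P} {f : A ⟶ X} {i : A ⟶ B} {j : X ⟶ Y}
    {g : B ⟶ Y} (h : IsPushout f i j g) (a : C(X, ℝ)) (b : C(B, ℝ))
    (hab : ∀ x, a (f.toMap x) = b (i.toMap x)) :
    ∃ k : C(Y, ℝ), (∀ x, k (j.toMap x) = a x) ∧ ∀ x, k (g.toMap x) = b x := by
  have w : f ≫ toLine a = i ≫ toLine b := hom_ext_apply fun x => congrArg ULift.up (hab x)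
  exact ⟨ofLine (h.desc _ _ w), fun x => congrArg ULift.down (hom_congr (h.inl_desc _ _ w) x),
    fun x => congrArg ULift.down (hom_congr (h.inr_desc _ _ w) x)⟩

end MDSpace

/-! ### Globes of disks and spheres -/

namespace GlobSpace

instance compactSpace {Z : Type u} [TopologicalSpace Z] [CompactSpace Z] :
    CompactSpace (GlobSpace Z) :=
  inferInstanceAs (CompactSpace (Quot (GlobRel Z)))

lemma exists_eq {Z : Type u} [TopologicalSpace Z] (x : GlobSpace Z) :
    (∃ b, x = state b) ∨ ∃ z t, x = point z t := by
  obtain ⟨b | ⟨z, t⟩⟩ := x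
  · exact .inl ⟨b, rfl⟩
  · exact .inr ⟨z, t, rfl⟩

instance compactSpace_disk (n : ℕ) : CompactSpace (Disk.{u} n) :=
  isCompact_iff_compactSpace.1 (isCompact_closedBall _ _)

/-- The function `(z, t) ↦ t (1 - t) z` on the globe of a set of vectors. -/
def scaled {E : Type u} [NormedAddCommGroup E] [NormedSpace ℝ E] {S : Set E} : GlobSpace S → E :=
  desc (fun _ => 0) (fun z t => ((t : ℝ) * (1 - t)) • (z : E)) (by simp) (by simp)

lemma scaled_point {E : Type u} [NormedAddCommGroup E] [NormedSpace ℝ E] {S : Set E} (z : S)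
    (t : I) : scaled (point z t) = ((t : ℝ) * (1 - t)) • (z : E) := rfl

/-- `height` recovers `t`, and `scaled` recovers `z` because `t (1 - t)` does not vanish. -/
lemma point_injective {E : Type u} [NormedAddCommGroup E] [NormedSpace ℝ E] {S : Set E} {z w : S}
    {t s : I} (h : point z t = point w s) (h0 : t ≠ 0) (h1 : t ≠ 1) : z = w ∧ t = s := by
  obtain rfl : t = s := congrArg height h
  refine ⟨?_, rfl⟩
  have h2 := congrArg scaled h
  rw [scaled_point, scaled_point] at h2
  have h3 : (t : ℝ) * (1 - t) ≠ 0 := by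
    refine mul_ne_zero (fun h => h0 (Subtype.ext h)) (fun h => h1 (Subtype.ext ?_))
    simpa using (sub_eq_zero.1 h).symm
  exact Subtype.ext (smul_right_injective E h3 h2)

lemma point_ne_state {Z : Type u} [TopologicalSpace Z] {z : Z} {t : I} (h0 : t ≠ 0) (h1 : t ≠ 1)
    (b : Bool) : point z t ≠ state b := by
  intro h
  have h2 : t = if b then 1 else 0 := congrArg height h
  cases b
  · exact h0 h2
  · exact h1 h2

end GlobSpace

lemma globIncl_injective (T : Ambient) (P : Reparam) (n : ℕ) :
    Function.Injective (globIncl.{u} T P n).toMap := by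
  have key : ∀ x : GlobSpace (Sphere.{u} n), (∃ b, x = .state b) ∨
      ∃ z t, t ≠ 0 ∧ t ≠ 1 ∧ x = .point z t := by
    intro x
    obtain h | ⟨z, t, rfl⟩ := x.exists_eq
    · exact .inl h
    by_cases h0 : t = 0
    · exact .inl ⟨false, h0 ▸ GlobSpace.point_zero z⟩
    by_cases h1 : t = 1
    · exact .inl ⟨true, h1 ▸ GlobSpace.point_one z⟩
    exact .inr ⟨z, t, h0, h1, rfl⟩
  intro x y h
  obtain ⟨b, rfl⟩ | ⟨z, t, h0, h1, rfl⟩ := key x <;>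
  obtain ⟨c, rfl⟩ | ⟨w, s, h0', h1', rfl⟩ := key y
  · have h' : (GlobSpace.state b : GlobSpace (Disk.{u} n)) = GlobSpace.state c := h
    have h2 := congrArg GlobSpace.height h'
    have h3 : (if b then (1 : I) else 0) = if c then 1 else 0 := h2
    have h4 : b = c := by
      clear h h' h2 key
      revert b c
      simp
    rw [h4]
  · exact absurd (Eq.symm h) (GlobSpace.point_ne_state h0' h1' b)
  · exact absurd h (GlobSpace.point_ne_state h0 h1 c)
  · obtain ⟨h2, rfl⟩ := GlobSpace.point_injective (E := Euc.{u} n) (S := Disk.{u} n) h h0 h1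
    have h3 : z = w := Subtype.ext (congrArg (fun v : Disk.{u} n => (v : Euc.{u} n)) h2)
    rw [h3]

instance (T : Ambient) (P : Reparam) (n : ℕ) : CompactSpace (globDisk.{u} T P n) :=
  inferInstanceAs (CompactSpace (GlobSpace (Disk.{u} n)))

instance (T : Ambient) (P : Reparam) (n : ℕ) : T2Space (globDisk.{u} T P n) :=
  inferInstanceAs (T2Space (GlobSpace (Disk.{u} n)))

instance (T : Ambient) (P : Reparam) (n : ℕ) : CompactSpace (globSphere.{u} T P n) :=
  inferInstanceAs (CompactSpace (GlobSpace (Sphere.{u} n)))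

lemma isClosedEmbedding_globIncl (T : Ambient) (P : Reparam) (n : ℕ) :
    IsClosedEmbedding (globIncl.{u} T P n).toMap :=
  (globIncl T P n).toMap.continuous.isClosedEmbedding (globIncl_injective T P n)

/-- A function on the globe of the sphere extends to the globe of the disk, with prescribed
value at a given point outside of the sphere. -/
lemma exists_globDisk_extension (T : Ambient) (P : Reparam) (n : ℕ) (f : C(globSphere.{u} T P n, ℝ)) :
    ∃ g : C(globDisk.{u} T P n, ℝ), ∀ x, g ((globIncl T P n).toMap x) = f x := by
  obtain ⟨g, hg⟩ := ContinuousMap.exists_extension (isClosedEmbedding_globIncl T P n) f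
  exact ⟨g, fun x => DFunLike.congr_fun hg x⟩

/-- Points of the globe of the disk outside of the globe of the sphere are separated from each
other and from the globe of the sphere by continuous functions. -/
lemma exists_globDisk_separation (T : Ambient) (P : Reparam) (n : ℕ) {p q : globDisk.{u} T P n}
    (hp : p ∉ Set.range (globIncl T P n).toMap) (hpq : p ≠ q) :
    ∃ g : C(globDisk.{u} T P n, ℝ), (∀ x, g ((globIncl T P n).toMap x) = 0) ∧ g q = 0 ∧
      g p = 1 := by
  obtain ⟨g, h0, h1, -⟩ := exists_continuous_zero_one_of_isClosed
    (s := Set.range (globIncl T P n).toMap ∪ {q}) (t := {p})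
    ((isClosedEmbedding_globIncl T P n).isClosed_range.union isClosed_singleton)
    isClosed_singleton (by
      rw [Set.disjoint_singleton_right]
      rintro (h | h)
      · exact hp h
      · exact hpq h)
  exact ⟨g, fun x => h0 (.inl ⟨x, rfl⟩), h0 (.inr rfl), h1 rfl⟩

/-! ### The tower of a cellular multipointed d-space -/

namespace CellularMDSpace

open MDSpace

variable {T : Ambient} {P : Reparam} (X : CellularMDSpace.{u} T P)

/-- The map from a stage of the tower to the whole space. -/
def incl (ν : Set.Iic X.lam) : X.tower.obj ν ⟶ X.total :=
  X.tower.map (homOfLE (Stage.le_last ν))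

variable {X}

lemma exists_normalizedComp_eq {U : Type*} [TopologicalSpace U] (γ₁ γ₂ : C(I, U)) (h : γ₁ 1 = γ₂ 0)
    (t : I) : ∃ s, normalizedComp γ₁ γ₂ h s = γ₁ t := by
  have h1 : γ₁ t ∈ Set.range ((Path.mk γ₁ rfl h).trans (Path.mk γ₂ rfl rfl)) := by
    rw [Path.trans_range]
    exact .inl ⟨t, rfl⟩
  exact h1

lemma map_incl {μ ν : Set.Iic X.lam} (h : μ ≤ ν) (x : X.tower.obj μ) :
    (X.incl ν).toMap ((X.tower.map (homOfLE h)).toMap x) = (X.incl μ).toMap x := by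
  refine hom_congr (f := X.tower.map (homOfLE h) ≫ X.incl ν) (g := X.incl μ) ?_ x
  exact (X.tower.map_comp _ _).symm

lemma incl_last (x : X.total) : (X.incl (Stage.last X.lam)).toMap x = x :=
  hom_congr (X.tower.map_id (Stage.last X.lam)) x

lemma incl_char (ν : Set.Iio X.lam) (p : globDisk.{u} T P (X.dim ν)) :
    (X.incl (Stage.next ν)).toMap ((X.char ν).toMap p) = (X.cellMap ν).toMap p := rfl

lemma cellMap_globIncl (ν : Set.Iio X.lam) (x : globSphere.{u} T P (X.dim ν)) :
    (X.cellMap ν).toMap ((globIncl T P (X.dim ν)).toMap x) =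
      (X.incl (Stage.of ν)).toMap ((X.attach ν).toMap x) := by
  rw [← map_incl (Stage.of_le_next ν), ← incl_char]
  congr 1
  exact (hom_congr (X.isPushout ν).w x).symm

/-- Transfinite induction for the three clauses of the tower; the work is to move zero, successor
and limit between ordinals and the bounded interval. -/
lemma tower_induction {p : Set.Iic X.lam → Prop} (zero : p (Stage.zero X.lam))
    (succ : ∀ ν : Set.Iio X.lam, p (Stage.of ν) → p (Stage.next ν))
    (limit : ∀ ν, Order.IsSuccLimit ν → (∀ μ < ν, p μ) → p ν) (ν : Set.Iic X.lam) : p ν := by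
  induction ν using WellFoundedLT.induction with
  | ind ν ih =>
    obtain h | ⟨μ, h⟩ | h := Ordinal.zero_or_succ_or_isSuccLimit ν.1
    · rwa [show ν = Stage.zero X.lam from Subtype.ext h]
    · have h1 : μ < ν.1 := h ▸ Order.lt_succ μ
      have h2 : μ < X.lam := h1.trans_le ν.2
      have h3 : ν = Stage.next ⟨μ, h2⟩ := Subtype.ext h.symm
      rw [h3]
      exact succ _ (ih _ h1)
    · refine limit ν ⟨fun h' => ?_, fun μ h' => ?_⟩ ih
      · refine h.1 fun b hb => ?_
        exact h' (b := ⟨b, hb.trans ν.2⟩) hb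
      · refine h.2 μ.1 ⟨h'.1, fun c hc hc' => ?_⟩
        exact h'.2 (c := ⟨c, hc'.le.trans ν.2⟩) hc hc'

lemma exists_extension_next (ν : Set.Iio X.lam) (f : C(X.tower.obj (Stage.of ν), ℝ)) :
    ∃ g : C(X.tower.obj (Stage.next ν), ℝ),
      ∀ x, g ((X.tower.map (homOfLE (Stage.of_le_next ν))).toMap x) = f x := by
  obtain ⟨b, hb⟩ := exists_globDisk_extension T P (X.dim ν) (f.comp (X.attach ν).toMap)
  obtain ⟨k, hk, -⟩ := MDSpace.IsPushout.exists_extension (X.isPushout ν) f b fun x => (hb x).symm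
  exact ⟨k, hk⟩

/-- Extension of functions is a left lifting property against the chaotic line, and left lifting
properties are stable under transfinite composition. -/
lemma exists_extension (ν : Set.Iic X.lam) (f : C(X.tower.obj ν, ℝ)) :
    ∃ g : C(X.total, ℝ), ∀ x, g ((X.incl ν).toMap x) = f x := by
  have := X.continuous
  -- The final stage is terminal among the stages above `ν`, hence it is the colimit of the tower
  -- restricted to them.
  let F : Set.Ici ν ⥤ MDSpace.{u} T P := (Subtype.mono_coe (· ∈ Set.Ici ν)).functor ⋙ X.tower
  have hT : Limits.IsTerminal (⟨Stage.last X.lam, Stage.le_last ν⟩ : Set.Ici ν) :=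
    Limits.IsTerminal.ofUniqueHom (fun j => homOfLE (Stage.le_last j.1))
      (fun _ _ => Subsingleton.elim _ _)
  have hF : ∀ j : Set.Ici ν, ¬ IsMax j →
      HasLiftingProperty (F.map (homOfLE (Order.le_succ j))) (toPoint (line T P)) := by
    intro j hj
    have h1 : j.1 < (Order.succ j).1 := Order.lt_succ_of_not_isMax hj
    let μ : Set.Iio X.lam := ⟨j.1.1, Set.mem_Iio.2 (lt_of_lt_of_le (b := (Order.succ j).1.1) h1 (Order.succ j).1.2)⟩
    have h2 : (Order.succ j).1 = Stage.next μ := by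
      refine le_antisymm ?_ (Order.succ_le_of_lt (a := j.1.1) (b := (Order.succ j).1.1) h1)
      have h4 : j.1 ≤ Stage.next μ := Stage.of_le_next μ
      have h3 : j < ⟨Stage.next μ, Set.mem_Ici.2 (le_trans (Set.mem_Ici.1 j.2) h4)⟩ :=
        Order.lt_succ j.1.1
      exact Order.succ_le_of_lt h3
    have key : ∀ b, b = Stage.next μ → ∀ h : Stage.of μ ≤ b,
        HasLiftingProperty (X.tower.map (homOfLE h)) (toPoint (line T P)) := by
      rintro _ rfl h
      exact hasLiftingProperty_line _ (exists_extension_next μ)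
    exact key _ h2 h1.le
  have h := HasLiftingProperty.transfiniteComposition.hasLiftingProperty_ι_app_bot
    (Limits.colimitOfDiagramTerminal hT F) hF
  exact exists_extension_of_hasLiftingProperty h f

lemma next_cases {ν : Set.Iio X.lam} (y : X.tower.obj (Stage.next ν)) :
    (∃ x, (X.tower.map (homOfLE (Stage.of_le_next ν))).toMap x = y) ∨
      ∃ p ∉ Set.range (globIncl T P (X.dim ν)).toMap, (X.char ν).toMap p = y := by
  obtain h | ⟨p, rfl⟩ := MDSpace.IsPushout.exists_eq (X.isPushout ν) y
  · exact .inl h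
  by_cases hp : p ∈ Set.range (globIncl T P (X.dim ν)).toMap
  · obtain ⟨x, rfl⟩ := hp
    exact .inl ⟨(X.attach ν).toMap x, hom_congr (X.isPushout ν).w x⟩
  · exact .inr ⟨p, hp, rfl⟩

lemma limit_cases {ν : Set.Iic X.lam} (h : Order.IsSuccLimit ν) (y : X.tower.obj ν) :
    ∃ μ, ∃ hμ : μ < ν, ∃ x, (X.tower.map (homOfLE hμ.le)).toMap x = y := by
  have := X.continuous
  obtain ⟨j, x, hx⟩ :=
    IsColimit.exists_eq (X.tower.isColimitOfIsWellOrderContinuous ν h) y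
  exact ⟨j.1, j.2, x, hx⟩

/-- A Urysohn function on the globe that vanishes on its boundary glues with zero on the previous
stage and then extends to the whole space. -/
lemma exists_cell_separation (ν : Set.Iio X.lam) {p q : globDisk.{u} T P (X.dim ν)}
    (hp : p ∉ Set.range (globIncl T P (X.dim ν)).toMap) (hpq : p ≠ q) :
    ∃ f : C(X.total, ℝ), f ((X.cellMap ν).toMap p) = 1 ∧ f ((X.cellMap ν).toMap q) = 0 ∧
      ∀ x, f ((X.incl (Stage.of ν)).toMap x) = 0 := by
  obtain ⟨b, hb, hq, hp⟩ := exists_globDisk_separation T P _ hp hpq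
  obtain ⟨k, h1, h2⟩ := MDSpace.IsPushout.exists_extension (X.isPushout ν) (ContinuousMap.const _ 0) b
    fun x => (hb x).symm
  obtain ⟨f, hf⟩ := exists_extension _ k
  refine ⟨f, ?_, ?_, fun x => ?_⟩
  · rw [← incl_char, hf, h2, hp]
  · rw [← incl_char, hf, h2, hq]
  · rw [← map_incl (Stage.of_le_next ν), hf, h1]
    rfl

lemma cellMap_ne (ν : Set.Iio X.lam) {p q : globDisk.{u} T P (X.dim ν)}
    (hp : p ∉ Set.range (globIncl T P (X.dim ν)).toMap) (hpq : p ≠ q) :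
    (X.cellMap ν).toMap p ≠ (X.cellMap ν).toMap q := by
  obtain ⟨f, h1, h0, -⟩ := exists_cell_separation ν hp hpq
  intro h
  rw [h, h0] at h1
  exact zero_ne_one h1

lemma globDisk_state_mem_range (n : ℕ) (b : Bool) :
    (GlobSpace.state b : GlobSpace (Disk.{u} n)) ∈ Set.range (globIncl T P n).toMap :=
  ⟨GlobSpace.state b, rfl⟩

lemma exists_cell_separation' (ν : Set.Iio X.lam) {p : globDisk.{u} T P (X.dim ν)}
    (hp : p ∉ Set.range (globIncl T P (X.dim ν)).toMap) :
    ∃ f : C(X.total, ℝ), f ((X.cellMap ν).toMap p) = 1 ∧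
      ∀ x, f ((X.incl (Stage.of ν)).toMap x) = 0 := by
  obtain ⟨f, h1, -, h⟩ := exists_cell_separation ν hp
    (q := (GlobSpace.state false : GlobSpace (Disk.{u} (X.dim ν))))
    (fun h => hp (h ▸ globDisk_state_mem_range _ _))
  exact ⟨f, h1, h⟩

lemma cellMap_ne_incl (ν : Set.Iio X.lam) {p : globDisk.{u} T P (X.dim ν)}
    (hp : p ∉ Set.range (globIncl T P (X.dim ν)).toMap) (x : X.tower.obj (Stage.of ν)) :
    (X.cellMap ν).toMap p ≠ (X.incl (Stage.of ν)).toMap x := by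
  obtain ⟨f, h1, h0⟩ := exists_cell_separation' ν hp
  intro h
  rw [h, h0] at h1
  exact zero_ne_one h1

/-- Two points of a successor stage either both come from the previous stage or are separated by a
function concentrated on the new cell; two points of a limit stage already live in a common earlier
one. -/
lemma exists_separation (ν : Set.Iic X.lam) : ∀ x y : X.tower.obj ν, x ≠ y →
    ∃ f : C(X.total, ℝ), f ((X.incl ν).toMap x) ≠ f ((X.incl ν).toMap y) := by
  refine tower_induction (p := fun ν => ∀ x y : X.tower.obj ν, x ≠ y →
    ∃ f : C(X.total, ℝ), f ((X.incl ν).toMap x) ≠ f ((X.incl ν).toMap y)) ?_ ?_ ?_ ν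
  · intro x y hxy
    classical
    have := X.zero_discrete
    obtain ⟨f, hf⟩ := exists_extension (Stage.zero X.lam)
      ⟨fun z => if z = x then 1 else 0, continuous_of_discreteTopology⟩
    exact ⟨f, by simp [hf, hxy.symm]⟩
  · intro ν ih x y hxy
    obtain ⟨x, rfl⟩ | ⟨p, hp, rfl⟩ := next_cases x <;>
    obtain ⟨y, rfl⟩ | ⟨q, hq, rfl⟩ := next_cases y
    · rw [map_incl, map_incl]
      exact ih x y fun h => hxy (h ▸ rfl)
    · obtain ⟨f, h1, h0⟩ := exists_cell_separation' ν hq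
      exact ⟨f, by rw [map_incl, incl_char, h1, h0]; exact zero_ne_one⟩
    · obtain ⟨f, h1, h0⟩ := exists_cell_separation' ν hp
      exact ⟨f, by rw [map_incl, incl_char, h1, h0]; exact one_ne_zero⟩
    · obtain ⟨f, h1, h0, -⟩ := exists_cell_separation ν hp fun h => hxy (h ▸ rfl)
      exact ⟨f, by rw [incl_char, incl_char, h1, h0]; exact one_ne_zero⟩
  · intro ν hν ih x y hxy
    obtain ⟨μ, hμ, x, rfl⟩ := limit_cases hν x
    obtain ⟨κ, hκ, y, rfl⟩ := limit_cases hν y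
    rw [map_incl, map_incl, ← map_incl (le_max_left μ κ), ← map_incl (le_max_right μ κ)]
    refine ih _ (max_lt hμ hκ) _ _ fun h => hxy ?_
    have h' := congrArg (X.tower.map (homOfLE (max_lt hμ hκ).le)).toMap h
    rw [← ContinuousMap.comp_apply, ← ContinuousMap.comp_apply, ← comp_toMap, ← comp_toMap,
      ← X.tower.map_comp, ← X.tower.map_comp] at h'
    exact h'

instance : T2Space X.total := by
  refine T2Space.of_injective_continuous (f := fun x (f : C(X.total, ℝ)) => f x) ?_ (by fun_prop)
  intro x y h
  by_contra hxy
  obtain ⟨f, hf⟩ := exists_separation (Stage.last X.lam) x y hxy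
  rw [incl_last, incl_last] at hf
  exact hf (congrFun h f)

/-! ### Cells and states -/

/-- Attaching a cell creates no state: both states of the globe of the disk already belong to the
globe of the sphere. -/
lemma exists_zero_of_mem_states (ν : Set.Iic X.lam) : ∀ x ∈ (X.tower.obj ν).states,
    ∃ y, (X.incl (Stage.zero X.lam)).toMap y = (X.incl ν).toMap x := by
  refine tower_induction (p := fun ν => ∀ x ∈ (X.tower.obj ν).states,
    ∃ y, (X.incl (Stage.zero X.lam)).toMap y = (X.incl ν).toMap x) ?_ ?_ ?_ ν
  · exact fun x _ => ⟨x, rfl⟩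
  · intro ν ih x hx
    obtain ⟨y, hy, rfl⟩ | ⟨_, ⟨b, rfl⟩, rfl⟩ := MDSpace.IsPushout.exists_state (X.isPushout ν) hx
    · rw [map_incl]
      exact ih y hy
    · obtain ⟨y, hy⟩ := ih _ ((X.attach ν).map_states (GlobSpace.state b) ⟨b, rfl⟩)
      exact ⟨y, hy.trans (cellMap_globIncl ν (GlobSpace.state b)).symm⟩
  · intro ν hν ih x hx
    have := X.continuous
    obtain ⟨j, y, hy, rfl⟩ :=
      IsColimit.exists_state (X.tower.isColimitOfIsWellOrderContinuous ν hν) hx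
    obtain ⟨z, hz⟩ := ih j.1 j.2 y hy
    exact ⟨z, hz.trans (map_incl (le_of_lt j.2) y).symm⟩

lemma mem_states_or_mem_openCell (x : X.total) : x ∈ X.total.states ∨ ∃ ν, x ∈ X.openCell ν := by
  have key : ∀ ν (x : X.tower.obj ν), (X.incl ν).toMap x ∈ X.total.states ∨
      ∃ μ, (X.incl ν).toMap x ∈ X.openCell μ := by
    refine tower_induction ?_ ?_ ?_
    · intro x
      exact .inl ((X.incl _).map_states x (X.zero_states ▸ trivial))
    · intro ν ih x
      obtain ⟨x, rfl⟩ | ⟨p, hp, rfl⟩ := next_cases x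
      · rw [map_incl]
        exact ih x
      · exact .inr ⟨ν, p, hp, rfl⟩
    · intro ν hν ih x
      obtain ⟨μ, hμ, x, rfl⟩ := limit_cases hν x
      rw [map_incl]
      exact ih μ hμ x
  simpa only [incl_last] using key (Stage.last X.lam) x

lemma notMem_states_of_mem_openCell {ν : Set.Iio X.lam} {x : X.total} (hx : x ∈ X.openCell ν) :
    x ∉ X.total.states := by
  intro h
  obtain ⟨p, hp, rfl⟩ := hx
  obtain ⟨y, hy⟩ := exists_zero_of_mem_states (Stage.last X.lam) _ h
  rw [incl_last] at hy
  have h0 : Stage.zero X.lam ≤ Stage.of ν := zero_le (a := ν.1)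
  refine cellMap_ne_incl ν hp ((X.tower.map (homOfLE h0)).toMap y) ?_
  rw [map_incl]
  exact hy.symm

lemma openCell_disjoint {μ ν : Set.Iio X.lam} {x : X.total} (hμ : x ∈ X.openCell μ)
    (hν : x ∈ X.openCell ν) : μ = ν := by
  wlog h : μ < ν generalizing μ ν
  · obtain h | h | h := lt_trichotomy μ ν
    · exact this hμ hν h
    · exact h
    · exact (this hν hμ h).symm
  obtain ⟨p, hp, rfl⟩ := hμ
  obtain ⟨q, hq, hpq⟩ := hν
  have h1 : Stage.next μ ≤ Stage.of ν := Order.succ_le_of_lt (a := μ.1) (b := ν.1) h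
  refine absurd ?_ (cellMap_ne_incl ν hq ((X.tower.map (homOfLE h1)).toMap ((X.char μ).toMap p)))
  rw [map_incl, incl_char, hpq]

/-- The topology is built by successive pushouts and limits, so closedness is checked cell by cell;
the hypothesis includes the inductive information needed on the boundary of the cell. -/
lemma isClosed_of_cells {A : Set X.total} (hA : ∀ ν : Set.Iio X.lam,
    IsClosed ((X.incl (Stage.of ν)).toMap ⁻¹' A) → IsClosed ((X.cellMap ν).toMap ⁻¹' A)) :
    IsClosed A := by
  have key : ∀ ν, IsClosed ((X.incl ν).toMap ⁻¹' A) := by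
    refine tower_induction ?_ ?_ ?_
    · have := X.zero_discrete
      exact isClosed_discrete _
    · intro ν ih
      refine MDSpace.IsPushout.isClosed (X.isPushout ν) ?_ (hA ν ih)
      convert ih using 1
      refine Set.ext fun x => ?_
      rw [Set.mem_preimage, Set.mem_preimage, Set.mem_preimage, map_incl]
    · intro ν hν ih
      have := X.continuous
      refine IsColimit.isClosed (X.tower.isColimitOfIsWellOrderContinuous ν hν) fun j => ?_
      have h1 : (X.tower.map (homOfLE (le_of_lt j.2))).toMap ⁻¹' ((X.incl ν).toMap ⁻¹' A) =
          (X.incl j.1).toMap ⁻¹' A := by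
        ext x
        rw [Set.mem_preimage, Set.mem_preimage, Set.mem_preimage, map_incl]
      exact (congrArg IsClosed h1).mpr (ih j.1 j.2)
  have h1 : (X.incl (Stage.last X.lam)).toMap ⁻¹' A = A := by
    ext x
    exact Iff.of_eq (congrArg (· ∈ A) (incl_last x))
  exact (congrArg IsClosed h1).mp (key (Stage.last X.lam))

lemma isClosed_of_thin {A : Set X.total} (hA : ∀ ν : Set.Iio X.lam,
    ((X.cellMap ν).toMap ⁻¹' A \ Set.range (globIncl T P (X.dim ν)).toMap).Subsingleton) :
    IsClosed A := by
  refine isClosed_of_cells fun ν h => ?_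
  have h1 := (isClosedEmbedding_globIncl T P (X.dim ν)).isClosedMap _
    (h.preimage (X.attach ν).toMap.continuous)
  -- The trace of `A` on the cell is its closed trace on the boundary together with at most one
  -- interior point.
  convert h1.union (hA ν).isClosed using 1
  ext p
  constructor
  · intro hp
    by_cases h2 : p ∈ Set.range (globIncl T P (X.dim ν)).toMap
    · obtain ⟨x, rfl⟩ := h2
      refine .inl ⟨x, ?_, rfl⟩
      simpa only [Set.mem_preimage, cellMap_globIncl] using hp
    · exact .inr ⟨hp, h2⟩
  · rintro (⟨x, hx, rfl⟩ | hp)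
    · simpa only [Set.mem_preimage, cellMap_globIncl] using hx
    · exact hp.1

/-! ### Execution paths -/

/-- A generating path over an interior point of the disk crosses the open cell when its height is
`1/2`; over a boundary point it already exists at the previous stage. Reparametrization and
composition keep such a point. This is what later forces cell paths to move. -/
lemma exists_notMem_states (ν : Set.Iic X.lam) : ∀ γ ∈ (X.tower.obj ν).paths,
    ∃ t, (X.incl ν).toMap (γ t) ∉ X.total.states := by
  refine tower_induction (p := fun ν => ∀ γ ∈ (X.tower.obj ν).paths,
    ∃ t, (X.incl ν).toMap (γ t) ∉ X.total.states) ?_ ?_ ?_ ν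
  · rw [X.zero_paths]
    simp
  · intro ν ih
    refine MDSpace.IsPushout.path_induction (X.isPushout ν)
      {γ | ∃ t, (X.incl (Stage.next ν)).toMap (γ t) ∉ X.total.states} ?_ ?_ ?_ ?_
    · rintro γ ⟨t, ht⟩ φ hφ
      obtain ⟨s, rfl⟩ := P.surjective hφ t
      exact ⟨s, ht⟩
    · rintro γ₁ ⟨t, ht⟩ γ₂ - h
      obtain ⟨s, hs⟩ := exists_normalizedComp_eq γ₁ γ₂ h t
      exact ⟨s, by rwa [hs]⟩
    · intro γ hγ
      obtain ⟨t, ht⟩ := ih γ hγ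
      exact ⟨t, by rwa [ContinuousMap.comp_apply, map_incl]⟩
    · rintro _ ⟨z, φ, hφ, rfl⟩
      by_cases hz : (z : Euc.{u} (X.dim ν)) ∈ Sphere.{u} (X.dim ν)
      · obtain ⟨t, ht⟩ := ih _ ((X.attach ν).map_paths _ ⟨⟨z, hz⟩, φ, hφ, rfl⟩)
        have h := cellMap_globIncl ν
          (GlobSpace.point (⟨z, hz⟩ : Sphere.{u} (X.dim ν)) (φ t))
        exact ⟨t, fun h' => ht ((congrArg (· ∈ X.total.states) h).mp h')⟩
      · obtain ⟨t, ht⟩ := P.surjective hφ ⟨1 / 2, by norm_num, by norm_num⟩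
        refine ⟨t, notMem_states_of_mem_openCell (ν := ν) ⟨_, ?_, rfl⟩⟩
        rintro ⟨x, hx⟩
        have h0 : φ t ≠ 0 := fun h => by
          have := congrArg Subtype.val (ht.symm.trans h)
          norm_num at this
        have h1 : φ t ≠ 1 := fun h => by
          have := congrArg Subtype.val (ht.symm.trans h)
          norm_num at this
        obtain ⟨b, rfl⟩ | ⟨w, s, rfl⟩ := GlobSpace.exists_eq (Z := Sphere.{u} (X.dim ν)) x
        · exact GlobSpace.point_ne_state h0 h1 b (Eq.symm hx)
        · have h2 := (GlobSpace.point_injective (E := Euc.{u} (X.dim ν))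
            (S := Disk.{u} (X.dim ν)) (Eq.symm hx) h0 h1).1
          exact hz (h2 ▸ w.2)
  · intro ν hν ih
    have := X.continuous
    refine IsColimit.path_induction (X.tower.isColimitOfIsWellOrderContinuous ν hν)
      {γ | ∃ t, (X.incl ν).toMap (γ t) ∉ X.total.states} ?_ ?_ ?_
    · rintro γ ⟨t, ht⟩ φ hφ
      obtain ⟨s, rfl⟩ := P.surjective hφ t
      exact ⟨s, ht⟩
    · rintro γ₁ ⟨t, ht⟩ γ₂ - h
      obtain ⟨s, hs⟩ := exists_normalizedComp_eq γ₁ γ₂ h t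
      exact ⟨s, by rwa [hs]⟩
    · intro j γ hγ
      obtain ⟨t, ht⟩ := ih j.1 j.2 γ hγ
      refine ⟨t, ?_⟩
      rw [← map_incl (le_of_lt j.2)] at ht
      exact ht

/-- The initial stage has no execution path and each pushout adds only those generated by one globe.
-/
lemma total_path_induction (S : Set C(I, X.total))
    (hr : ∀ γ ∈ S, ∀ φ ∈ P.maps, γ.comp φ ∈ S)
    (hs : ∀ γ₁ ∈ S, ∀ γ₂ ∈ S, ∀ h : γ₁ 1 = γ₂ 0, normalizedComp γ₁ γ₂ h ∈ S)
    (hcell : ∀ (ν : Set.Iio X.lam) (z : Disk.{u} (X.dim ν)), ∀ φ ∈ P.maps,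
      ((X.cellMap ν).toMap.comp (GlobSpace.delta z)).comp φ ∈ S) : X.total.paths ⊆ S := by
  have key : ∀ ν, (X.tower.obj ν).paths ⊆ {γ | (X.incl ν).toMap.comp γ ∈ S} := by
    have hr' : ∀ ν, ∀ γ ∈ {γ | (X.incl ν).toMap.comp γ ∈ S}, ∀ φ ∈ P.maps,
        γ.comp φ ∈ {γ | (X.incl ν).toMap.comp γ ∈ S} := fun ν γ h φ hφ => hr _ h φ hφ
    have hs' : ∀ ν, ∀ γ₁ ∈ {γ | (X.incl ν).toMap.comp γ ∈ S},
        ∀ γ₂ ∈ {γ | (X.incl ν).toMap.comp γ ∈ S}, ∀ h : γ₁ 1 = γ₂ 0,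
        normalizedComp γ₁ γ₂ h ∈ {γ | (X.incl ν).toMap.comp γ ∈ S} := by
      intro ν γ₁ h1 γ₂ h2 h
      have h' : ((X.incl ν).toMap.comp γ₁) 1 = ((X.incl ν).toMap.comp γ₂) 0 :=
        congrArg (X.incl ν).toMap h
      change (X.incl ν).toMap.comp (normalizedComp γ₁ γ₂ h) ∈ S
      rw [normalizedComp_comp _ _ _ h h']
      exact hs _ h1 _ h2 h'
    refine tower_induction ?_ ?_ ?_
    · rw [X.zero_paths]
      exact Set.empty_subset _
    · intro ν ih
      refine MDSpace.IsPushout.path_induction (X.isPushout ν) _ (hr' _) (hs' _) ?_ ?_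
      · intro γ hγ
        have h := ih hγ
        have h1 : (X.incl (Stage.next ν)).toMap.comp
            ((X.tower.map (homOfLE (Stage.of_le_next ν))).toMap.comp γ) =
            (X.incl (Stage.of ν)).toMap.comp γ := ContinuousMap.ext fun t => map_incl _ _
        exact Set.mem_ofPred.2 (h1 ▸ h)
      · rintro _ ⟨z, φ, hφ, rfl⟩
        exact hcell ν z φ hφ
    · intro ν hν ih
      have := X.continuous
      refine IsColimit.path_induction (X.tower.isColimitOfIsWellOrderContinuous ν hν) _
        (hr' _) (hs' _) ?_
      intro j γ hγ
      have h := ih j.1 j.2 hγ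
      have h1 : (X.incl ν).toMap.comp
          ((X.tower.map (homOfLE (le_of_lt j.2))).toMap.comp γ) =
          (X.incl j.1).toMap.comp γ := ContinuousMap.ext fun t => map_incl _ _
      exact Set.mem_ofPred.2 (h1 ▸ h)
  intro γ hγ
  have h1 : (X.incl (Stage.last X.lam)).toMap.comp γ = γ :=
    ContinuousMap.ext fun t => incl_last _
  have h : (X.incl (Stage.last X.lam)).toMap.comp γ ∈ S := key (Stage.last X.lam) hγ
  rwa [h1] at h

end CellularMDSpace

/-! ### A metrization criterion -/

/-- The image of a second countable space under a closed map with compact fibers is second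
countable. -/
lemma secondCountableTopology_of_isClosedMap {Z Y : Type*} [TopologicalSpace Z]
    [TopologicalSpace Y] [SecondCountableTopology Z] {f : Z → Y}
    (hcont : Continuous f) (hs : Function.Surjective f) (hc : IsClosedMap f)
    (hf : ∀ y, IsCompact (f ⁻¹' {y})) : SecondCountableTopology Y := by
  classical
  -- `W F` is the largest subset of `Y` whose preimage lies in `⋃₀ F`; it is open because `f` is
  -- closed. Compact fibers allow `F` to be finite, so countably many such sets suffice.
  let W : Set (Set Z) → Set Y := fun F => (f '' (⋃₀ F)ᶜ)ᶜ
  have hcount : {F : Set (Set Z) | F.Finite ∧ F ⊆ countableBasis Z}.Countable :=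
    Set.countable_ofPred_finite_subset (countable_countableBasis Z)
  have hb : IsTopologicalBasis (W '' {F : Set (Set Z) | F.Finite ∧ F ⊆ countableBasis Z}) := by
    refine isTopologicalBasis_of_isOpen_of_nhds ?_ ?_
    · rintro _ ⟨F, ⟨-, hF⟩, rfl⟩
      refine (hc _ (isOpen_sUnion fun U hU => ?_).isClosed_compl).isOpen_compl
      exact (isBasis_countableBasis Z).isOpen (hF hU)
    · intro y O hy hO
      obtain ⟨F, hFs, hF, hyF⟩ := (hf y).elim_finite_subcover_image
        (b := {U | U ∈ countableBasis Z ∧ U ⊆ f ⁻¹' O}) (c := id)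
        (fun U hU => (isBasis_countableBasis Z).isOpen hU.1) (fun z hz => by
          have hz' : f z = y := hz
          obtain ⟨U, hU, hzU, hUO⟩ := (isBasis_countableBasis Z).exists_subset_of_mem_open
            (Set.mem_preimage.2 (hz'.symm ▸ hy : f z ∈ O)) (hO.preimage hcont)
          exact Set.mem_biUnion (x := U) ⟨hU, hUO⟩ hzU)
      refine ⟨W F, ⟨F, ⟨hF, fun U hU => (hFs hU).1⟩, rfl⟩, ?_, ?_⟩
      · rintro ⟨z, hz, hzy⟩
        refine hz ?_
        rw [Set.sUnion_eq_biUnion]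
        exact hyF hzy
      · intro x hx
        obtain ⟨z, rfl⟩ := hs x
        by_contra hzO
        refine hx ⟨z, ?_, rfl⟩
        rintro ⟨U, hU, hzU⟩
        exact hzO ((hFs hU).2 hzU)
  exact hb.secondCountableTopology (hcount.image W)

/-- A space mapping to a discrete set with open metrizable fibers is metrizable. -/
lemma metrizableSpace_of_isLocallyConstant {Y Q : Type*} [TopologicalSpace Y] {π : Y → Q}
    (hπ : IsLocallyConstant π) (h : ∀ q, MetrizableSpace {y // π y = q}) : MetrizableSpace Y := by
  let e : (Σ q, {y // π y = q}) ≃ₜ Y := (Equiv.sigmaFiberEquiv π).toHomeomorphOfContinuousOpen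
    (continuous_sigma fun q => continuous_subtype_val)
    (isOpenMap_sigma.2 fun q => (hπ.isOpen_fiber q).isOpenMap_subtype_val)
  let := fun q => metrizableSpaceMetric {y // π y = q}
  let : MetricSpace (Σ q, {y // π y = q}) := Metric.Sigma.metricSpace
  exact e.symm.isEmbedding.metrizableSpace

lemma countable_setOf_reflTransGen {ι : Type*} {r : ι → ι → Prop} (hr : ∀ i, {j | r i j}.Finite)
    (i : ι) : {j | Relation.ReflTransGen r i j}.Countable := by
  let S : ℕ → Set ι := fun n => Nat.rec {i} (fun _ A => ⋃ a ∈ A, {b | r a b}) n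
  have hS : ∀ n, (S n).Countable := by
    intro n
    induction n with
    | zero => exact Set.countable_singleton i
    | succ n ih => exact ih.biUnion fun a _ => (hr a).countable
  refine (Set.countable_iUnion hS).mono fun j hj => ?_
  induction (Set.mem_ofPred.1 hj) with
  | refl => exact Set.mem_iUnion.2 ⟨0, rfl⟩
  | tail h1 h2 ih =>
    obtain ⟨n, hn⟩ := Set.mem_iUnion.1 (ih h1)
    exact Set.mem_iUnion.2 ⟨n + 1, Set.mem_biUnion hn h2⟩

/-- A Hausdorff space with a locally finite cover by second countable compact subspaces is
metrizable. -/
theorem metrizableSpace_of_locallyFinite_compact {Y : Type*} [TopologicalSpace Y] [T2Space Y]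
    {ι : Type*} {K : ι → Set Y} (hK : LocallyFinite K) (hc : ∀ i, IsCompact (K i))
    (hs : ∀ i, SecondCountableTopology (K i)) (hU : ⋃ i, K i = Set.univ) : MetrizableSpace Y := by
  have hex : ∀ y, ∃ i, y ∈ K i := fun y => Set.mem_iUnion.1 (hU ▸ Set.mem_univ y)
  have hwlc : WeaklyLocallyCompactSpace Y := by
    refine ⟨fun y => ?_⟩
    obtain ⟨U, hU, hf⟩ := hK y
    refine ⟨⋃ i ∈ {i | (K i ∩ U).Nonempty}, K i, hf.isCompact_biUnion fun i _ => hc i,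
      Filter.mem_of_superset hU fun x hx => ?_⟩
    obtain ⟨i, hi⟩ := hex x
    exact Set.mem_biUnion (x := i) ⟨x, hi, hx⟩ hi
  -- Members of the cover are linked when they meet. Each has finitely many neighbours, so each
  -- class is countable, and the classes split the space into clopen pieces.
  let r : ι → ι → Prop := fun i j => (K i ∩ K j).Nonempty
  have hfin : ∀ i, {j | r i j}.Finite := fun i => by
    refine (hK.finite_nonempty_inter_compact (hc i)).subset fun j hj => ?_
    exact Set.mem_ofPred.2 (by rw [Set.inter_comm]; exact hj)
  have hsymm : ∀ {i j}, r i j → r j i := fun {i j} h => by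
    change (K j ∩ K i).Nonempty
    rw [Set.inter_comm]; exact h
  have hcount : ∀ q : Quot r, {i | Quot.mk r i = q}.Countable := by
    rintro ⟨i₀⟩
    refine (countable_setOf_reflTransGen hfin i₀).mono fun i hi => ?_
    let L : Quot r → Set ι := Quot.lift (fun i => {j | Relation.ReflTransGen r i j}) (by
      intro a b hab
      ext j
      exact ⟨fun h => (Relation.ReflTransGen.single (hsymm hab)).trans h,
        fun h => (Relation.ReflTransGen.single hab).trans h⟩)
    have h : L (Quot.mk r i) = L (Quot.mk r i₀) := congrArg L hi
    have h' : i ∈ L (Quot.mk r i) := Relation.ReflTransGen.refl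
    rw [h] at h'
    exact h'
  choose idx hidx using hex
  let π : Y → Quot r := fun y => Quot.mk r (idx y)
  have hπ : ∀ {y i}, y ∈ K i → π y = Quot.mk r i := fun {y i} h =>
    Quot.sound ⟨y, hidx y, h⟩
  have hclosed : ∀ A : Set (Quot r), IsClosed (π ⁻¹' A) := by
    intro A
    -- A union of classes is a locally finite union of compacta, hence closed; applied to
    -- complements as well, this gives open fibers.
    have h : π ⁻¹' A = ⋃ i : {i // Quot.mk r i ∈ A}, K i := by
      ext y
      constructor
      · intro hy
        exact Set.mem_iUnion.2 ⟨⟨idx y, hy⟩, hidx y⟩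
      · intro hy
        obtain ⟨i, hi⟩ := Set.mem_iUnion.1 hy
        rw [Set.mem_preimage, hπ hi]
        exact i.2
    rw [h]
    exact (hK.comp_injective Subtype.val_injective).isClosed_iUnion fun i => (hc i).isClosed
  have hlc : IsLocallyConstant π := fun A => by
    rw [← isClosed_compl_iff, ← Set.preimage_compl]
    exact hclosed _
  refine metrizableSpace_of_isLocallyConstant hlc fun q => ?_
  have hctb : Countable {i // Quot.mk r i = q} := (hcount q).to_subtype
  -- The piece is the image of a countable disjoint union of second countable compacta under a
  -- closed map with finite fibers, hence second countable.
  let f : (Σ i : {i // Quot.mk r i = q}, K i) → {y // π y = q} :=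
    fun p => ⟨p.2, (hπ p.2.2).trans p.1.2⟩
  have hfcont : Continuous f :=
    Continuous.subtype_mk (continuous_sigma fun i => continuous_subtype_val) _
  have hfs : Function.Surjective f := fun y => ⟨⟨⟨idx y, y.2⟩, ⟨y, hidx y⟩⟩, rfl⟩
  have hfc : IsClosedMap f := by
    intro S hS
    let f₀ : ∀ i : {i // Quot.mk r i = q}, K i → Σ i : {i // Quot.mk r i = q}, K i :=
      fun i x => ⟨i, x⟩
    have h : f '' S = Subtype.val ⁻¹'
        ⋃ i : {i // Quot.mk r i = q}, Subtype.val '' ((fun x : K i => f₀ i x) ⁻¹' S) := by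
      ext y
      constructor
      · rintro ⟨⟨i, x⟩, hx, rfl⟩
        exact Set.mem_iUnion.2 ⟨i, x, hx, rfl⟩
      · intro hy
        obtain ⟨i, x, hx, hxy⟩ := Set.mem_iUnion.1 hy
        exact ⟨⟨i, x⟩, hx, Subtype.ext hxy⟩
    rw [h]
    refine IsClosed.preimage continuous_subtype_val (LocallyFinite.isClosed_iUnion ?_ ?_)
    · refine (hK.comp_injective Subtype.val_injective).subset fun i => ?_
      rintro _ ⟨x, -, rfl⟩
      exact x.2
    · intro i
      exact (hc i).isClosed.isClosedMap_subtype_val _ (isClosed_sigma_iff.1 hS i)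
  have hfib : ∀ y, IsCompact (f ⁻¹' {y}) := by
    intro y
    have h : (f ⁻¹' {y}).Finite := by
      refine Set.Finite.of_finite_image (f := fun p => p.1.1) ?_ ?_
      · refine (hK.point_finite y.1).subset ?_
        rintro _ ⟨⟨i, x⟩, rfl, rfl⟩
        exact x.2
      · rintro ⟨i, x⟩ hx ⟨j, z⟩ hz hij
        obtain rfl : i = j := Subtype.ext hij
        have h : f ⟨i, x⟩ = f ⟨i, z⟩ := Eq.trans hx (Eq.symm hz)
        have h' : x = z := Subtype.ext (congrArg (fun y => y.1) h)
        rw [h']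
    exact h.isCompact
  have := secondCountableTopology_of_isClosedMap hfcont hfs hfc hfib
  -- A weakly locally compact Hausdorff space is regular, so Urysohn's metrization theorem applies
  -- to the piece.
  infer_instance

/-! ### Topology of locally finite cellular multipointed d-spaces -/

namespace CellularMDSpace

open MDSpace

variable {T : Ambient} {P : Reparam} {X : CellularMDSpace.{u} T P}

/-- A set is thin if it meets every open cell in at most one point. -/
def Thin (A : Set X.total) : Prop := ∀ ν, (A ∩ X.openCell ν).Subsingleton

lemma Thin.mono {A B : Set X.total} (hB : Thin B) (h : A ⊆ B) : Thin A :=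
  fun ν => (hB ν).anti (Set.inter_subset_inter_left _ h)

lemma Thin.isClosed {A : Set X.total} (hA : Thin A) : IsClosed A := by
  refine isClosed_of_thin fun ν p hp q hq => ?_
  by_contra hpq
  exact cellMap_ne ν hp.2 hpq (hA ν ⟨hp.1, p, hp.2, rfl⟩ ⟨hq.1, q, hq.2, rfl⟩)

/-- Every subset of a thin set is thin, hence closed; the intersection is therefore compact and
discrete. -/
lemma Thin.finite_inter {A K : Set X.total} (hA : Thin A) (hK : IsCompact K) : (K ∩ A).Finite := by
  refine (hK.inter_right hA.isClosed).finite ⟨discreteTopology_iff_forall_isClosed.2 fun s => ?_⟩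
  have h : s = Subtype.val ⁻¹' (Subtype.val '' s) :=
    (Set.preimage_image_eq s Subtype.val_injective).symm
  rw [h]
  refine (Thin.isClosed (hA.mono ?_)).preimage continuous_subtype_val
  rintro _ ⟨x, -, rfl⟩
  exact x.2.2

lemma thin_states : Thin (X := X) X.total.states := fun _ _ hx =>
  absurd hx.1 (notMem_states_of_mem_openCell hx.2)

lemma isCompact_closedCell (ν : Set.Iio X.lam) : IsCompact (X.closedCell ν) :=
  isCompact_range (X.cellMap ν).toMap.continuous

lemma openCell_subset_closedCell (ν : Set.Iio X.lam) : X.openCell ν ⊆ X.closedCell ν :=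
  Set.image_subset_range _ _

/-- One point chosen in each open cell met by `K` gives a thin subset of `K`. -/
lemma finite_openCell_inter {K : Set X.total} (hK : IsCompact K) :
    {ν | (K ∩ X.openCell ν).Nonempty}.Finite := by
  obtain hempty | hne := isEmpty_or_nonempty X.total
  · exact Set.finite_empty.subset fun ν ⟨x, _⟩ => (hempty.false x).elim
  choose! x hx using fun ν (h : (K ∩ X.openCell ν).Nonempty) => h
  have hthin : Thin (x '' {ν | (K ∩ X.openCell ν).Nonempty}) := by
    rintro ν _ ⟨⟨μ, hμ, rfl⟩, h1⟩ _ ⟨⟨κ, hκ, rfl⟩, h2⟩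
    rw [openCell_disjoint (hx μ hμ).2 h1, openCell_disjoint (hx κ hκ).2 h2]
  refine Set.Finite.of_finite_image (f := x) ((hthin.finite_inter hK).subset ?_) ?_
  · rintro _ ⟨ν, hν, rfl⟩
    exact ⟨(hx ν hν).1, ν, hν, rfl⟩
  · intro μ hμ ν hν h
    exact openCell_disjoint (hx μ hμ).2 (h ▸ (hx ν hν).2)

/-! ### Local finiteness of the closed cells and metrizability. -/

namespace LocallyFinite

variable (hX : X.LocallyFinite)
include hX

lemma finite_closedCell_mem (x : X.total) : {ν | x ∈ X.closedCell ν}.Finite := by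
  obtain h | ⟨μ, hμ⟩ := mem_states_or_mem_openCell x
  · exact hX.state x h
  · exact (hX.cell μ).subset fun ν hν => ⟨x, hν, hμ⟩

/-- A point of `K` is a state or lies in an open cell; `K` contains finitely many states and meets
finitely many open cells, and each of these touches finitely many closed cells. -/
lemma finite_closedCell_inter {K : Set X.total} (hK : IsCompact K) :
    {ν | (X.closedCell ν ∩ K).Nonempty}.Finite := by
  refine (((finite_openCell_inter hK).biUnion fun ν _ => hX.cell ν).union
    ((thin_states.finite_inter hK).biUnion fun α hα => hX.state α hα.2)).subset ?_
  rintro ν ⟨x, hx, hK⟩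
  obtain h | ⟨μ, hμ⟩ := mem_states_or_mem_openCell x
  · exact .inr (Set.mem_biUnion (x := x) ⟨hK, h⟩ hx)
  · exact .inl (Set.mem_biUnion (x := μ) ⟨x, hK, hμ⟩ ⟨x, hx, hμ⟩)

/-- Within a given cell only finitely many members of the union are visible, because its closed cell
is compact. -/
lemma isClosed_biUnion_closedCell (J : Set (Set.Iio X.lam)) :
    IsClosed (⋃ ν ∈ J, X.closedCell ν) := by
  refine isClosed_of_cells fun μ _ => ?_
  have h : (X.cellMap μ).toMap ⁻¹' (⋃ ν ∈ J, X.closedCell ν) = (X.cellMap μ).toMap ⁻¹'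
      (⋃ ν ∈ J ∩ {ν | (X.closedCell ν ∩ X.closedCell μ).Nonempty}, X.closedCell ν) := by
    ext p
    constructor
    · intro hp
      obtain ⟨ν, hν, h⟩ := Set.mem_iUnion₂.1 hp
      exact Set.mem_biUnion (x := ν) ⟨hν, _, h, p, rfl⟩ h
    · intro hp
      obtain ⟨ν, hν, h⟩ := Set.mem_iUnion₂.1 hp
      exact Set.mem_biUnion (x := ν) hν.1 h
  rw [h]
  refine IsClosed.preimage (X.cellMap μ).toMap.continuous ?_
  exact ((hX.finite_closedCell_inter (isCompact_closedCell μ)).inter_of_right J).isClosed_biUnion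
    fun ν _ => (isCompact_closedCell ν).isClosed

lemma locallyFinite_closedCell : _root_.LocallyFinite X.closedCell := by
  intro x
  -- The neighbourhood is the complement of all closed cells missing `x`.
  refine ⟨_, (hX.isClosed_biUnion_closedCell {ν | x ∉ X.closedCell ν}).isOpen_compl.mem_nhds ?_,
    (hX.finite_closedCell_mem x).subset ?_⟩
  · intro h
    obtain ⟨ν, hν, h'⟩ := Set.mem_iUnion₂.1 h
    exact hν h'
  · rintro ν ⟨y, hy, hy'⟩
    by_contra h
    exact hy' (Set.mem_biUnion (x := ν) h hy)

omit hX in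
lemma locallyFinite_states : _root_.LocallyFinite fun α : X.total.states => {(α : X.total)} := by
  intro x
  refine ⟨_, (thin_states.mono Set.sdiff_subset :
    Thin (X := X) (X.total.states \ {x})).isClosed.isOpen_compl.mem_nhds (by simp),
    (Set.Finite.subset (Set.Finite.preimage Subtype.val_injective.injOn (Set.finite_singleton x))
      ?_)⟩
  rintro α ⟨_, rfl, h⟩
  by_contra h'
  exact h ⟨α.2, h'⟩

omit hX in
lemma secondCountableTopology_closedCell (ν : Set.Iio X.lam) :
    SecondCountableTopology (X.closedCell ν) := by
  let f : Bool ⊕ Disk.{u} (X.dim ν) × I → X.closedCell ν :=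
    fun x => ⟨(X.cellMap ν).toMap (Quot.mk _ x : GlobSpace (Disk.{u} (X.dim ν))), _, rfl⟩
  have hf : Continuous f :=
    ((X.cellMap ν).toMap.continuous.comp continuous_quot_mk).subtype_mk _
  refine secondCountableTopology_of_isClosedMap hf ?_ hf.isClosedMap fun y =>
    (isClosed_singleton.preimage hf).isCompact
  rintro ⟨_, x, rfl⟩
  obtain ⟨x, rfl⟩ := Quot.exists_rep (x : GlobSpace (Disk.{u} (X.dim ν)))
  exact ⟨x, rfl⟩

theorem metrizableSpace_total : MetrizableSpace X.total := by
  refine metrizableSpace_of_locallyFinite_compact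
    (K := Sum.elim X.closedCell fun α : X.total.states => {(α : X.total)})
    (hX.locallyFinite_closedCell.sumElim locallyFinite_states) ?_ ?_ ?_
  · rintro (ν | α)
    · exact isCompact_closedCell ν
    · exact isCompact_singleton
  · rintro (ν | α)
    · exact secondCountableTopology_closedCell ν
    · exact inferInstanceAs (SecondCountableTopology ({(α : X.total)} : Set X.total))
  · refine Set.eq_univ_of_forall fun x => ?_
    obtain h | ⟨μ, hμ⟩ := mem_states_or_mem_openCell x
    · exact Set.mem_iUnion.2 ⟨.inr ⟨x, h⟩, rfl⟩
    · exact Set.mem_iUnion.2 ⟨.inl μ, openCell_subset_closedCell μ hμ⟩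

end LocallyFinite

end CellularMDSpace

/-! ### Reparametrizations -/

namespace Reparam

/-- Both categories are described by order conditions, stable under convex combinations and gluing;
strictness is the only difference. -/
lemma mem_maps_iff (P : Reparam) (φ : C(I, I)) : φ ∈ P.maps ↔
    Monotone φ ∧ φ 0 = 0 ∧ φ 1 = 1 ∧ (P = .G → StrictMono φ) := by
  have hsurj : φ 0 = 0 → φ 1 = 1 → Function.Surjective φ := fun h0 h1 t => by
    have h := intermediate_value_univ (0 : I) 1 φ.continuous
    rw [h0, h1] at h
    exact h ⟨unitInterval.nonneg', unitInterval.le_one'⟩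
  constructor
  · intro h
    refine ⟨P.monotone h, P.map_zero h, P.map_one h, ?_⟩
    rintro rfl
    exact h.1.strictMono_of_injective h.2.bijective.injective
  · rintro ⟨hm, h0, h1, hG⟩
    cases P
    · exact ⟨hm, isHomeomorph_iff_continuous_bijective.2
        ⟨φ.continuous, (hG rfl).injective, hsurj h0 h1⟩⟩
    · exact ⟨hm, hsurj h0 h1⟩

end Reparam

namespace unitInterval

/-- The map `t ↦ min (2t) 1`. -/
noncomputable def doubleLeft (t : I) : I := Set.projIcc 0 1 zero_le_one (2 * (t : ℝ))

/-- The map `t ↦ max (2t - 1) 0`. -/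
noncomputable def doubleRight (t : I) : I := Set.projIcc 0 1 zero_le_one (2 * (t : ℝ) - 1)

lemma continuous_doubleLeft : Continuous doubleLeft :=
  continuous_projIcc.comp (by fun_prop)

lemma continuous_doubleRight : Continuous doubleRight :=
  continuous_projIcc.comp (by fun_prop)

lemma monotone_doubleLeft : Monotone doubleLeft := fun s t h =>
  Set.monotone_projIcc _ (by have : (s : ℝ) ≤ t := h; linarith)

lemma monotone_doubleRight : Monotone doubleRight := fun s t h =>
  Set.monotone_projIcc _ (by have : (s : ℝ) ≤ t := h; linarith)

/-- The map `t ↦ t / 2`. -/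
noncomputable def halfLeft : C(I, I) :=
  ⟨fun t => ⟨(t : ℝ) / 2, by have := t.2.1; linarith, by have := t.2.2; linarith⟩, by fun_prop⟩

/-- The map `t ↦ (1 + t) / 2`. -/
noncomputable def halfRight : C(I, I) :=
  ⟨fun t => ⟨(1 + (t : ℝ)) / 2, by have := t.2.1; linarith, by have := t.2.2; linarith⟩,
    by fun_prop⟩

lemma doubleLeft_halfLeft (t : I) : doubleLeft (halfLeft t) = t := by
  refine Subtype.ext ?_
  have h1 := t.2.1
  have h2 := t.2.2
  have h : 2 * ((t : ℝ) / 2) = t := by ring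
  change ((Set.projIcc (0 : ℝ) 1 zero_le_one (2 * ((t : ℝ) / 2)) : I) : ℝ) = t
  rw [h, Set.projIcc_of_mem _ t.2]

lemma doubleRight_halfRight (t : I) : doubleRight (halfRight t) = t := by
  refine Subtype.ext ?_
  have h : 2 * ((1 + (t : ℝ)) / 2) - 1 = t := by ring
  change ((Set.projIcc (0 : ℝ) 1 zero_le_one (2 * ((1 + (t : ℝ)) / 2) - 1) : I) : ℝ) = t
  rw [h, Set.projIcc_of_mem _ t.2]

end unitInterval

open unitInterval

/-! ### Normalized composition and gluing of reparametrizations. -/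

section normalizedComp

variable {U : Type*} [TopologicalSpace U] {γ₁ γ₂ : C(I, U)} {h : γ₁ 1 = γ₂ 0}

lemma normalizedComp_of_le {t : I} (ht : (t : ℝ) ≤ 1 / 2) :
    normalizedComp γ₁ γ₂ h t = γ₁ (doubleLeft t) := by
  change (Path.trans (Path.mk γ₁ rfl h) (Path.mk γ₂ rfl rfl)) t = _
  rw [Path.trans_apply, dif_pos ht, doubleLeft, Set.projIcc_of_mem]
  rfl

lemma normalizedComp_of_ge {t : I} (ht : 1 / 2 ≤ (t : ℝ)) :
    normalizedComp γ₁ γ₂ h t = γ₂ (doubleRight t) := by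
  obtain ht | ht := ht.lt_or_eq
  · change (Path.trans (Path.mk γ₁ rfl h) (Path.mk γ₂ rfl rfl)) t = _
    rw [Path.trans_apply, dif_neg (not_le.2 ht), doubleRight, Set.projIcc_of_mem]
    rfl
  · have h1 : doubleLeft t = 1 := by
      rw [doubleLeft, ← ht]; norm_num
    have h2 : doubleRight t = 0 := by
      rw [doubleRight, ← ht]; norm_num
    rw [normalizedComp_of_le ht.ge, h1, h2, h]

/-- Two reparametrizations, one after the other. -/
noncomputable def glue (φ ψ : C(I, I)) (h : halfLeft (φ 1) = halfRight (ψ 0)) : C(I, I) :=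
  normalizedComp (halfLeft.comp φ) (halfRight.comp ψ) h

/-- Reparametrizations of the factors can be moved outside the composition, which brings every
execution path to the form of a composite followed by one reparametrization. -/
lemma normalizedComp_comp_glue {φ ψ : C(I, I)} (hφψ : halfLeft (φ 1) = halfRight (ψ 0))
    (h' : (γ₁.comp φ) 1 = (γ₂.comp ψ) 0) :
    normalizedComp (γ₁.comp φ) (γ₂.comp ψ) h' = (normalizedComp γ₁ γ₂ h).comp (glue φ ψ hφψ) := by
  ext t
  rw [ContinuousMap.comp_apply, glue]
  obtain ht | ht := le_total (t : ℝ) (1 / 2)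
  · rw [normalizedComp_of_le ht, normalizedComp_of_le ht, ContinuousMap.comp_apply,
      ContinuousMap.comp_apply, normalizedComp_of_le, doubleLeft_halfLeft]
    have := (φ (doubleLeft t)).2.2
    change (φ (doubleLeft t) : ℝ) / 2 ≤ 1 / 2
    linarith
  · rw [normalizedComp_of_ge ht, normalizedComp_of_ge ht, ContinuousMap.comp_apply,
      ContinuousMap.comp_apply, normalizedComp_of_ge, doubleRight_halfRight]
    have := (ψ (doubleRight t)).2.1
    change 1 / 2 ≤ (1 + (ψ (doubleRight t) : ℝ)) / 2
    linarith

lemma strictMonoOn_doubleLeft : StrictMonoOn doubleLeft {t | (t : ℝ) ≤ 1 / 2} := by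
  intro s hs t ht hst
  have h : (s : ℝ) < t := hst
  have hs' : (s : ℝ) ≤ 1 / 2 := hs
  have ht' : (t : ℝ) ≤ 1 / 2 := ht
  rw [doubleLeft, doubleLeft, Set.projIcc_of_mem _ ⟨by linarith [s.2.1], by linarith⟩,
    Set.projIcc_of_mem _ ⟨by linarith [t.2.1], by linarith⟩]
  exact Subtype.mk_lt_mk.2 (by linarith)

lemma strictMonoOn_doubleRight : StrictMonoOn doubleRight {t | 1 / 2 ≤ (t : ℝ)} := by
  intro s hs t ht hst
  have h : (s : ℝ) < t := hst
  have hs' : 1 / 2 ≤ (s : ℝ) := hs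
  have ht' : 1 / 2 ≤ (t : ℝ) := ht
  rw [doubleRight, doubleRight, Set.projIcc_of_mem _ ⟨by linarith, by linarith [s.2.2]⟩,
    Set.projIcc_of_mem _ ⟨by linarith, by linarith [t.2.2]⟩]
  exact Subtype.mk_lt_mk.2 (by linarith)

lemma glue_mem (P : Reparam) {φ ψ : C(I, I)} (hφψ : halfLeft (φ 1) = halfRight (ψ 0))
    (hφ : φ ∈ P.maps) (hψ : ψ ∈ P.maps) : glue φ ψ hφψ ∈ P.maps := by
  rw [P.mem_maps_iff] at *
  have hl : StrictMono halfLeft := fun s t h => by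
    have h : (s : ℝ) < t := h
    exact Subtype.mk_lt_mk.2 (by linarith)
  have hr : StrictMono halfRight := fun s t h => by
    have h : (s : ℝ) < t := h
    exact Subtype.mk_lt_mk.2 (by linarith)
  let m : I := ⟨1 / 2, by norm_num, by norm_num⟩
  have hL : Set.EqOn (fun t => halfLeft (φ (doubleLeft t))) (glue φ ψ hφψ) (Set.Iic m) :=
    fun t ht => (normalizedComp_of_le (γ₁ := halfLeft.comp φ) (γ₂ := halfRight.comp ψ)
      (h := hφψ) ht).symm
  have hR : Set.EqOn (fun t => halfRight (ψ (doubleRight t))) (glue φ ψ hφψ) (Set.Ici m) :=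
    fun t ht => (normalizedComp_of_ge (γ₁ := halfLeft.comp φ) (γ₂ := halfRight.comp ψ)
      (h := hφψ) ht).symm
  refine ⟨?_, ?_, ?_, fun hG => ?_⟩
  · refine MonotoneOn.Iic_union_Ici (a := m) ?_ ?_
    · exact ((hl.monotone.comp (hφ.1.comp monotone_doubleLeft)).monotoneOn _).congr hL
    · exact ((hr.monotone.comp (hψ.1.comp monotone_doubleRight)).monotoneOn _).congr hR
  · rw [glue, normalizedComp_of_le (by norm_num)]
    refine Subtype.ext ?_
    have h : doubleLeft 0 = 0 := by rw [doubleLeft]; norm_num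
    rw [h, ContinuousMap.comp_apply, hφ.2.1]
    change (0 : ℝ) / 2 = 0
    norm_num
  · rw [glue, normalizedComp_of_ge (by norm_num)]
    refine Subtype.ext ?_
    have h : doubleRight 1 = 1 := by rw [doubleRight]; norm_num
    rw [h, ContinuousMap.comp_apply, hψ.2.2.1]
    change (1 + (1 : ℝ)) / 2 = 1
    norm_num
  · refine StrictMonoOn.Iic_union_Ici (a := m) ?_ ?_
    · exact (hl.comp_strictMonoOn ((hφ.2.2.2 hG).comp_strictMonoOn
        strictMonoOn_doubleLeft)).congr hL
    · exact (hr.comp_strictMonoOn ((hψ.2.2.2 hG).comp_strictMonoOn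
        strictMonoOn_doubleRight)).congr hR

end normalizedComp

/-! ### Execution paths as reparametrized composites of cell paths -/

namespace CellularMDSpace

open MDSpace

variable {T : Ambient} {P : Reparam} (X : CellularMDSpace.{u} T P)

/-- The path `t ↦ (z, t)` in the cell `ν`. -/
def cellPath (ν : Set.Iio X.lam) (z : Disk.{u} (X.dim ν)) : C(I, X.total) :=
  (X.cellMap ν).toMap.comp (GlobSpace.delta z)

/-- The iterated normalized compositions of cell paths, with a given bracketing. -/
inductive IsComposite : FreeMagma (Set.Iio X.lam) → C(I, X.total) → Prop
  | of (ν : Set.Iio X.lam) (z : Disk.{u} (X.dim ν)) : IsComposite (.of ν) (X.cellPath ν z)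
  | mul {a b : FreeMagma (Set.Iio X.lam)} {γ₁ γ₂ : C(I, X.total)} (h₁ : IsComposite a γ₁)
    (h₂ : IsComposite b γ₂) (h : γ₁ 1 = γ₂ 0) : IsComposite (.mul a b) (normalizedComp γ₁ γ₂ h)

variable {X}

lemma id_mem_maps (P : Reparam) : ContinuousMap.id I ∈ P.maps :=
  (P.mem_maps_iff _).2 ⟨monotone_id, rfl, rfl, fun _ => strictMono_id⟩

lemma cellPath_mem (ν : Set.Iio X.lam) (z : Disk.{u} (X.dim ν)) :
    X.cellPath ν z ∈ X.total.paths :=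
  (X.cellMap ν).map_paths _ ⟨z, ContinuousMap.id I, id_mem_maps P, rfl⟩

lemma IsComposite.mem_paths {a : FreeMagma (Set.Iio X.lam)} {γ : C(I, X.total)}
    (h : X.IsComposite a γ) : γ ∈ X.total.paths := by
  induction h with
  | of ν z => exact cellPath_mem ν z
  | mul _ _ h ih₁ ih₂ => exact X.total.comp_mem _ ih₁ _ ih₂ h

lemma exists_isComposite {γ : C(I, X.total)} (hγ : γ ∈ X.total.paths) :
    ∃ a c, X.IsComposite a c ∧ ∃ φ ∈ P.maps, γ = c.comp φ := by
  refine total_path_induction {γ | ∃ a c, X.IsComposite a c ∧ ∃ φ ∈ P.maps, γ = c.comp φ}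
    ?_ ?_ ?_ hγ
  · rintro _ ⟨a, c, hc, φ, hφ, rfl⟩ ψ hψ
    exact ⟨a, c, hc, φ.comp ψ, P.comp_mem hφ hψ, rfl⟩
  · rintro _ ⟨a, c, hc, φ, hφ, rfl⟩ _ ⟨b, d, hd, ψ, hψ, rfl⟩ h
    have h' : c 1 = d 0 := by
      rw [ContinuousMap.comp_apply, ContinuousMap.comp_apply, P.map_one hφ, P.map_zero hψ] at h
      exact h
    have hφψ : halfLeft (φ 1) = halfRight (ψ 0) := by
      rw [P.map_one hφ, P.map_zero hψ]
      refine Subtype.ext ?_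
      change (1 : ℝ) / 2 = (1 + 0) / 2
      norm_num
    exact ⟨_, _, hc.mul hd h', _, glue_mem P hφψ hφ hψ, normalizedComp_comp_glue hφψ h⟩
  · intro ν z φ hφ
    exact ⟨_, _, .of ν z, φ, hφ, rfl⟩

/-- All paths of one globe share their endpoints, so those of a composite depend only on its first
and last letters. Parameters of different factors can thus be varied independently. -/
lemma IsComposite.endpoints {a : FreeMagma (Set.Iio X.lam)} {γ γ' : C(I, X.total)}
    (h : X.IsComposite a γ) (h' : X.IsComposite a γ') : γ 0 = γ' 0 ∧ γ 1 = γ' 1 := by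
  induction h generalizing γ' with
  | of ν z =>
    obtain ⟨_, z'⟩ := h'
    exact ⟨congrArg (X.cellMap ν).toMap
        ((GlobSpace.point_zero z).trans (GlobSpace.point_zero z').symm),
      congrArg (X.cellMap ν).toMap ((GlobSpace.point_one z).trans (GlobSpace.point_one z').symm)⟩
  | mul _ _ h ih₁ ih₂ =>
    obtain _ | ⟨h₁', h₂', k⟩ := h'
    rw [normalizedComp_zero, normalizedComp_zero, normalizedComp_one, normalizedComp_one]
    exact ⟨(ih₁ h₁').1, (ih₂ h₂').2⟩

lemma continuous_cellPath (ν : Set.Iio X.lam) : Continuous (X.cellPath ν) := by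
  refine ContinuousMap.continuous_of_continuous_uncurry _ ?_
  exact (X.cellMap ν).toMap.continuous.comp GlobSpace.continuous_point

/-- The composites with a given bracketing are parametrized by a compact convex set. -/
lemma exists_parametrization (a : FreeMagma (Set.Iio X.lam)) :
    ∃ (V : Type u) (_ : NormedAddCommGroup V) (_ : NormedSpace ℝ V) (K : Set V)
      (F : C(K, C(I, X.total))), IsCompact K ∧ Convex ℝ K ∧ Set.range F = {γ | X.IsComposite a γ} := by
  induction a using FreeMagma.rec with
  | of ν =>
    refine ⟨Euc.{u} (X.dim ν), inferInstance, inferInstance, Disk.{u} (X.dim ν),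
      ⟨X.cellPath ν, continuous_cellPath ν⟩, isCompact_closedBall _ _, convex_closedBall _ _, ?_⟩
    ext γ
    constructor
    · rintro ⟨z, rfl⟩
      exact .of ν z
    · rintro ⟨_, z⟩
      exact ⟨z, rfl⟩
  | mul a b iha ihb =>
    obtain ⟨V, _, _, K, F, hK, hKc, hF⟩ := iha
    obtain ⟨W, _, _, L, G, hL, hLc, hG⟩ := ihb
    have hFa : ∀ v, X.IsComposite a (F v) := fun v => by
      have : F v ∈ {γ | X.IsComposite a γ} := hF ▸ ⟨v, rfl⟩
      exact this
    have hGb : ∀ v, X.IsComposite b (G v) := fun v => by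
      have : G v ∈ {γ | X.IsComposite b γ} := hG ▸ ⟨v, rfl⟩
      exact this
    by_cases h : ∃ γ, X.IsComposite (.mul a b) γ
    · obtain ⟨γ, _ | ⟨h₁, h₂, h⟩⟩ := h
      -- One existing composite makes all pairs composable, so the parameter set is the full product
      -- and stays convex.
      have hFG : ∀ v w, F v 1 = G w 0 := fun v w => by
        rw [((hFa v).endpoints h₁).2, h, ((hGb w).endpoints h₂).1]
      refine ⟨V × W, inferInstance, inferInstance, K ×ˢ L, ⟨fun p =>
        normalizedComp (F ⟨p.1.1, p.2.1⟩) (G ⟨p.1.2, p.2.2⟩) (hFG _ _), ?_⟩,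
        hK.prod hL, hKc.prod hLc, ?_⟩
      · refine ContinuousMap.continuous_of_continuous_uncurry _ ?_
        have hF' : Continuous fun q : ↥(K ×ˢ L) × I =>
            F ⟨q.1.1.1, q.1.2.1⟩ (doubleLeft q.2) :=
          (F.continuous.comp (by fun_prop)).eval (continuous_doubleLeft.comp continuous_snd)
        have hG' : Continuous fun q : ↥(K ×ˢ L) × I =>
            G ⟨q.1.1.2, q.1.2.2⟩ (doubleRight q.2) :=
          (G.continuous.comp (by fun_prop)).eval (continuous_doubleRight.comp continuous_snd)
        have key := Continuous.if_le hF' hG' (f := fun q => (q.2 : ℝ)) (g := fun _ => 1 / 2)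
          (by fun_prop) continuous_const (fun q hq => by
            rw [← normalizedComp_of_le (h := hFG _ _) hq.le, normalizedComp_of_ge hq.ge])
        refine key.congr fun q => ?_
        split_ifs with hq
        · exact (normalizedComp_of_le hq).symm
        · exact (normalizedComp_of_ge (not_le.1 hq).le).symm
      · ext γ
        constructor
        · rintro ⟨p, rfl⟩
          exact .mul (hFa _) (hGb _) _
        · rintro (_ | ⟨h₁, h₂, h⟩)
          rename_i γ₁ γ₂
          obtain ⟨v, rfl⟩ : γ₁ ∈ Set.range F := hF ▸ h₁
          obtain ⟨w, rfl⟩ : γ₂ ∈ Set.range G := hG ▸ h₂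
          exact ⟨⟨(v.1, w.1), v.2, w.2⟩, rfl⟩
    · refine ⟨PUnit, inferInstance, inferInstance, ∅, ⟨fun x => x.2.elim, ?_⟩, isCompact_empty,
        convex_empty, ?_⟩
      · exact continuous_of_discreteTopology
      · ext γ
        constructor
        · rintro ⟨x, -⟩
          exact x.2.elim
        · intro hγ
          exact (h ⟨γ, hγ⟩).elim

end CellularMDSpace

/-! ### Convergent sequences of execution paths -/

namespace FreeMagma

/-- The set of generators occurring in an element of a free magma. -/
def letters {α : Type*} : FreeMagma α → Set α
  | .of x => {x}
  | .mul a b => letters a ∪ letters b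

lemma finite_setOf_letters_subset {α : Type*} {C : Set α} (hC : C.Finite) (n : ℕ) :
    {a : FreeMagma α | a.letters ⊆ C ∧ a.length ≤ n}.Finite := by
  induction n with
  | zero => exact Set.finite_empty.subset fun a ha => absurd ha.2 (by
      have := a.length_pos; omega)
  | succ n ih =>
    refine ((hC.image FreeMagma.of).union (Set.Finite.image2 FreeMagma.mul ih ih)).subset ?_
    rintro (x | ⟨a, b⟩) ⟨h, hn⟩
    · exact .inl ⟨x, h rfl, rfl⟩
    · have h1 : a.length + b.length ≤ n + 1 := hn
      have := a.length_pos
      have := b.length_pos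
      exact .inr ⟨a, ⟨Set.subset_union_left.trans h, by omega⟩,
        b, ⟨Set.subset_union_right.trans h, by omega⟩, rfl⟩

end FreeMagma

namespace CellularMDSpace

open MDSpace unitInterval

variable {T : Ambient} {P : Reparam} {X : CellularMDSpace.{u} T P}

lemma range_normalizedComp {U : Type*} [TopologicalSpace U] (γ₁ γ₂ : C(I, U)) (h : γ₁ 1 = γ₂ 0) :
    Set.range (normalizedComp γ₁ γ₂ h) = Set.range γ₁ ∪ Set.range γ₂ :=
  Path.trans_range (Path.mk γ₁ rfl h) (Path.mk γ₂ rfl rfl)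

lemma IsComposite.exists_range_subset {a : FreeMagma (Set.Iio X.lam)} {c : C(I, X.total)}
    (hc : X.IsComposite a c) {ν : Set.Iio X.lam} (hν : ν ∈ a.letters) :
    ∃ z, Set.range (X.cellPath ν z) ⊆ Set.range c := by
  induction hc with
  | of μ z =>
    obtain rfl : ν = μ := hν
    exact ⟨z, subset_rfl⟩
  | mul _ _ h ih₁ ih₂ =>
    rw [range_normalizedComp]
    obtain hν | hν := hν
    · obtain ⟨z, hz⟩ := ih₁ hν
      exact ⟨z, hz.trans Set.subset_union_left⟩
    · obtain ⟨z, hz⟩ := ih₂ hν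
      exact ⟨z, hz.trans Set.subset_union_right⟩

/-- The path starts at a state and leaves the set of states. -/
lemma exists_cellPath_ne (ν : Set.Iio X.lam) (z : Disk.{u} (X.dim ν)) :
    ∃ t, X.cellPath ν z t ≠ X.cellPath ν z 0 := by
  obtain ⟨t, ht⟩ := exists_notMem_states (Stage.last X.lam) _ (cellPath_mem ν z)
  refine ⟨t, fun h => ht ?_⟩
  refine (congrArg (· ∈ X.total.states) ((incl_last (X.cellPath ν z t)).trans h)).mpr ?_
  exact X.total.zero_mem _ (cellPath_mem ν z)

/-- A composite of paths each of which moves by at least `ε` takes at least a time `δ` for each of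
its factors, if it moves by less than `ε` in any time less than `δ`. -/
lemma IsComposite.length_mul_le {D : X.total → X.total → ℝ} {ε δ : ℝ}
    {a : FreeMagma (Set.Iio X.lam)} {c : C(I, X.total)} (hc : X.IsComposite a c)
    (hε : ∀ ν ∈ a.letters, ∀ z, ∃ s s', ε ≤ D (X.cellPath ν z s) (X.cellPath ν z s')) {x y : ℝ}
    (hxy : x ≤ y) {φ : ℝ → I} (hφ : ContinuousOn φ (Set.Icc x y)) (hm : MonotoneOn φ (Set.Icc x y))
    (hx : φ x = 0) (hy : φ y = 1) (hδ : ∀ t ∈ Set.Icc x y, ∀ t' ∈ Set.Icc x y, |t - t'| < δ →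
      D (c (φ t)) (c (φ t')) < ε) : a.length * δ ≤ y - x := by
  induction hc generalizing x y φ with
  | of ν z =>
    obtain ⟨s, s', h⟩ := hε ν rfl z
    have hsurj : ∀ s : I, ∃ t ∈ Set.Icc x y, φ t = s := fun s => by
      have h := intermediate_value_Icc hxy hφ
      rw [hx, hy] at h
      exact h ⟨unitInterval.nonneg', unitInterval.le_one'⟩
    obtain ⟨t, ht, rfl⟩ := hsurj s
    obtain ⟨t', ht', rfl⟩ := hsurj s'
    -- The path moves by at least `ε` between `t` and `t'`, which is impossible in a time less than
    -- `δ`.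
    have h1 : δ ≤ |t - t'| := by
      by_contra! hlt
      exact absurd (hδ t ht t' ht' hlt) (not_lt.2 h)
    have h2 : |t - t'| ≤ y - x := abs_sub_le_iff.2
      ⟨by linarith [ht.1, ht.2, ht'.1, ht'.2], by linarith [ht.1, ht.2, ht'.1, ht'.2]⟩
    change ((1 : ℕ) : ℝ) * δ ≤ y - x
    rw [Nat.cast_one, one_mul]
    exact h1.trans h2
  | @mul a b γ₁ γ₂ _ _ h ih₁ ih₂ =>
    -- The interval is cut at a time when the reparametrization reaches `1/2`; each half then
    -- traverses one factor completely.
    obtain ⟨m, hm', hmφ⟩ : ∃ m ∈ Set.Icc x y, φ m = ⟨1 / 2, by norm_num, by norm_num⟩ := by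
      have h := intermediate_value_Icc hxy hφ
      rw [hx, hy] at h
      exact h ⟨unitInterval.nonneg', unitInterval.le_one'⟩
    have hL : Set.Icc x m ⊆ Set.Icc x y := Set.Icc_subset_Icc_right hm'.2
    have hR : Set.Icc m y ⊆ Set.Icc x y := Set.Icc_subset_Icc_left hm'.1
    have hleft : ∀ t ∈ Set.Icc x m, γ₁ (doubleLeft (φ t)) = normalizedComp γ₁ γ₂ h (φ t) := by
      intro t ht
      have h1 : φ t ≤ φ m := hm (hL ht) hm' ht.2
      rw [hmφ] at h1
      exact (normalizedComp_of_le h1).symm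
    have hright : ∀ t ∈ Set.Icc m y, γ₂ (doubleRight (φ t)) = normalizedComp γ₁ γ₂ h (φ t) := by
      intro t ht
      have h1 : φ m ≤ φ t := hm hm' (hR ht) ht.1
      rw [hmφ] at h1
      exact (normalizedComp_of_ge h1).symm
    have h₁ := ih₁ (fun ν hν => hε ν (.inl hν)) hm'.1 (φ := doubleLeft ∘ φ)
      (continuous_doubleLeft.comp_continuousOn (hφ.mono hL))
      (monotone_doubleLeft.comp_monotoneOn (hm.mono hL))
      (by rw [Function.comp_apply, hx, doubleLeft]; norm_num)
      (by rw [Function.comp_apply, hmφ, doubleLeft]; norm_num)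
      (fun t ht t' ht' htt => by
        rw [Function.comp_apply, Function.comp_apply, hleft t ht, hleft t' ht']
        exact hδ t (hL ht) t' (hL ht') htt)
    have h₂ := ih₂ (fun ν hν => hε ν (.inr hν)) hm'.2 (φ := doubleRight ∘ φ)
      (continuous_doubleRight.comp_continuousOn (hφ.mono hR))
      (monotone_doubleRight.comp_monotoneOn (hm.mono hR))
      (by rw [Function.comp_apply, hmφ, doubleRight]; norm_num)
      (by rw [Function.comp_apply, hy, doubleRight]; norm_num)
      (fun t ht t' ht' htt => by
        rw [Function.comp_apply, Function.comp_apply, hright t ht, hright t' ht']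
        exact hδ t (hR ht) t' (hR ht') htt)
    change ((a.length + b.length : ℕ) : ℝ) * δ ≤ y - x
    push_cast
    linarith

lemma exists_pos_le_dist_cellPath {D : MetricSpace X.total}
    (hD : D.toPseudoMetricSpace.toUniformSpace.toTopologicalSpace = X.total.top)
    (ν : Set.Iio X.lam) : ∃ ε > 0, ∀ z, ∃ s, ε ≤ D.dist (X.cellPath ν z s) (X.cellPath ν z 0) := by
  let := D.replaceTopology hD.symm
  change ∃ ε > 0, ∀ z, ∃ s, ε ≤ dist (X.cellPath ν z s) (X.cellPath ν z 0)
  have hcont : Continuous fun z => dist (X.cellPath ν z)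
      (ContinuousMap.const I (X.cellPath ν z 0)) := by
    refine (continuous_cellPath ν).dist (ContinuousMap.continuous_of_continuous_uncurry _ ?_)
    exact ((continuous_eval_const 0).comp (continuous_cellPath ν)).comp continuous_fst
  -- The bound is the minimum, over the compact disk, of the uniform distance from a cell path to
  -- the constant path at its starting point.
  obtain ⟨z₀, -, hz₀⟩ := (isCompact_univ (X := Disk.{u} (X.dim ν))).exists_isMinOn
    ⟨⟨0, by simp⟩, trivial⟩ hcont.continuousOn
  have hpos : 0 < dist (X.cellPath ν z₀) (ContinuousMap.const I (X.cellPath ν z₀ 0)) := by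
    obtain ⟨t, ht⟩ := exists_cellPath_ne ν z₀
    exact dist_pos.2 fun h => ht (DFunLike.congr_fun h t)
  refine ⟨_, hpos, fun z => ?_⟩
  by_contra! h
  have h' := (ContinuousMap.dist_lt_iff (f := X.cellPath ν z)
    (g := ContinuousMap.const I (X.cellPath ν z 0)) hpos).2 h
  exact absurd (hz₀ (Set.mem_univ z)) (not_le.2 h')

/-- A convergent sequence of execution paths of a locally finite cellular multipointed d-space has
a subsequence of reparametrized composites with the same bracketing of the same cells. -/
theorem LocallyFinite.exists_frequently_isComposite (hX : X.LocallyFinite)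
    {γ : ℕ → C(I, X.total)} {γ' : C(I, X.total)} (hγ : Filter.Tendsto γ Filter.atTop (𝓝 γ'))
    (hp : ∀ n, γ n ∈ X.total.paths) :
    ∃ a, ∃ᶠ n in Filter.atTop, ∃ c, X.IsComposite a c ∧ ∃ φ ∈ P.maps, γ n = c.comp φ := by
  have := hX.metrizableSpace_total
  let D := metrizableSpaceMetric X.total
  choose a c hc φ hφ hcφ using fun n => exists_isComposite (hp n)
  let S : Set C(I, X.total) := insert γ' (Set.range γ)
  have hS : IsCompact S := hγ.isCompact_insert_range
  have hmem : ∀ n, γ n ∈ S := fun n => .inr ⟨n, rfl⟩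
  -- `K` contains the images of all the `γ n`; every letter of `a n` names a cell whose closure
  -- meets it.
  let K : Set X.total := (fun q : C(I, X.total) × I => q.1 q.2) '' (S ×ˢ Set.univ)
  have hcont : Continuous fun q : C(I, X.total) × I => q.1 q.2 := by fun_prop
  have hK : IsCompact K := (hS.prod isCompact_univ).image hcont
  let C : Set (Set.Iio X.lam) := {ν | (X.closedCell ν ∩ K).Nonempty}
  have hC : C.Finite := hX.finite_closedCell_inter hK
  have hletters : ∀ n, (a n).letters ⊆ C := by
    intro n ν hν
    obtain ⟨z, hz⟩ := (hc n).exists_range_subset hν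
    obtain ⟨s, hs⟩ := hz ⟨0, rfl⟩
    obtain ⟨t, rfl⟩ := P.surjective (hφ n) s
    refine ⟨X.cellPath ν z 0, ⟨_, rfl⟩, (γ n, t), ⟨hmem n, trivial⟩, ?_⟩
    rw [← hs, hcφ n]
    rfl
  choose e he0 he using fun ν => exists_pos_le_dist_cellPath (X := X) (D := D) rfl ν
  obtain ⟨ε, hε, hε0⟩ : ∃ ε, (∀ ν ∈ C, ε < e ν) ∧ 0 < ε := by
    have h1 : ∀ᶠ ε in 𝓝[>] (0 : ℝ), ∀ ν ∈ C, ε < e ν :=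
      (Filter.eventually_all_finite hC).2 fun ν _ => nhdsWithin_le_nhds (Iio_mem_nhds (he0 ν))
    exact (h1.and self_mem_nhdsWithin).exists
  -- Uniform continuity of evaluation on the compact set `S × I` gives one modulus for all the
  -- paths.
  obtain ⟨δ, hδ0, hδ⟩ := Metric.uniformContinuousOn_iff.1
    ((hS.prod (isCompact_univ (X := I))).uniformContinuousOn_of_continuous hcont.continuousOn) ε hε0
  have hlen : ∀ n, ((a n).length : ℝ) * δ ≤ 1 := by
    intro n
    have h := (hc n).length_mul_le (D := dist) (ε := ε) (δ := δ)
      (fun ν hν z => (he ν z).imp fun s hs => ⟨0, (hε ν (hletters n hν)).le.trans hs⟩)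
      zero_le_one (φ := fun t => φ n (Set.projIcc 0 1 zero_le_one t))
      ((φ n).continuous.comp continuous_projIcc).continuousOn
      (((P.monotone (hφ n)).comp (Set.monotone_projIcc _)).monotoneOn _)
      (by rw [Set.projIcc_left]; exact P.map_zero (hφ n))
      (by rw [Set.projIcc_right]; exact P.map_one (hφ n))
      (fun t ht t' ht' htt => by
        have h := hδ (γ n, Set.projIcc 0 1 zero_le_one t) ⟨hmem n, trivial⟩
          (γ n, Set.projIcc 0 1 zero_le_one t') ⟨hmem n, trivial⟩ (by
            rw [Prod.dist_eq, dist_self, max_lt_iff]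
            refine ⟨hδ0, ?_⟩
            rw [Subtype.dist_eq, Set.projIcc_of_mem _ ht, Set.projIcc_of_mem _ ht']
            exact htt)
        rw [hcφ n] at h
        exact h)
    simpa using h
  obtain ⟨N, hN⟩ := exists_nat_ge (1 / δ)
  have hfin : (Set.range a).Finite := by
    refine (FreeMagma.finite_setOf_letters_subset hC N).subset ?_
    rintro _ ⟨n, rfl⟩
    refine ⟨hletters n, ?_⟩
    have h : ((a n).length : ℝ) ≤ N := ((le_div_iff₀ hδ0).2 (hlen n)).trans hN
    exact_mod_cast h
  by_contra hno
  have hall : ∀ᶠ n in Filter.atTop, ∀ b ∈ Set.range a, ¬ ∃ c, X.IsComposite b c ∧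
      ∃ φ ∈ P.maps, γ n = c.comp φ :=
    (Filter.eventually_all_finite hfin).2 fun b _ => Filter.not_frequently.1 fun h => hno ⟨b, h⟩
  obtain ⟨n, hn⟩ := hall.exists
  exact hn (a n) ⟨n, rfl⟩ ⟨c n, hc n, φ n, hφ n, hcφ n⟩

end CellularMDSpace

/-! ### Piecewise linear interpolation of sequences of reparametrized paths -/

section Interpolation

open Filter
open scoped NNReal

variable {V : Type*} [NormedAddCommGroup V] [NormedSpace ℝ V]

/-- The piecewise linear interpolation of a sequence. -/
noncomputable def interpolate (a : ℕ → V) (u : ℝ≥0) : V :=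
  AffineMap.lineMap (a ⌊u⌋₊) (a (⌊u⌋₊ + 1)) ((u : ℝ) - ⌊u⌋₊)

/-- The formula includes the right end of the interval, so the affine pieces agree on overlaps and
continuity follows from a locally finite closed cover. -/
lemma interpolate_eq (a : ℕ → V) {n : ℕ} {u : ℝ≥0} (h : u ∈ Set.Icc (n : ℝ≥0) (n + 1)) :
    interpolate a u = AffineMap.lineMap (a n) (a (n + 1)) ((u : ℝ) - n) := by
  obtain h' | h' := h.2.lt_or_eq
  · rw [interpolate, (Nat.floor_eq_iff zero_le).2 ⟨h.1, h'⟩]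
  · have h1 : ⌊u⌋₊ = n + 1 := by
      rw [h']
      exact_mod_cast Nat.floor_natCast (R := ℝ≥0) (n + 1)
    rw [interpolate, h1, h']
    simp

lemma interpolate_natCast (a : ℕ → V) (n : ℕ) : interpolate a n = a n := by
  rw [interpolate_eq a (n := n) ⟨le_rfl, le_self_add⟩]
  simp

lemma continuous_interpolate (a : ℕ → V) : Continuous (interpolate a) := by
  refine LocallyFinite.continuous (f := fun n : ℕ => Set.Icc (n : ℝ≥0) (n + 1)) ?_ ?_
    (fun n => isClosed_Icc) fun n => ?_
  · intro u
    refine ⟨Set.Iio (⌊u⌋₊ + 1), Iio_mem_nhds (Nat.lt_floor_add_one u),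
      (Set.finite_Iic (⌊u⌋₊ + 1)).subset ?_⟩
    rintro n ⟨x, hx, hx'⟩
    have h : (n : ℝ≥0) ≤ (⌊u⌋₊ + 1 : ℕ) := by
      push_cast
      exact hx.1.trans hx'.le
    exact Nat.cast_le.1 h
  · exact Set.eq_univ_of_forall fun u => Set.mem_iUnion.2
      ⟨⌊u⌋₊, Nat.floor_le zero_le, (Nat.lt_floor_add_one u).le⟩
  · refine ContinuousOn.congr (Continuous.continuousOn ?_) fun u hu => interpolate_eq a hu
    exact AffineMap.lineMap_continuous.comp (by fun_prop)

lemma interpolate_mem {K : Set V} (hK : Convex ℝ K) {a : ℕ → V} {u : ℝ≥0}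
    (h : ∀ n ≥ ⌊u⌋₊, a n ∈ K) : interpolate a u ∈ K := by
  refine hK.lineMap_mem (h _ le_rfl) (h _ (Nat.le_succ _)) ⟨?_, ?_⟩
  · exact sub_nonneg.2 (by exact_mod_cast Nat.floor_le (zero_le (a := u)))
  · have h : (u : ℝ) < ⌊u⌋₊ + 1 := by exact_mod_cast Nat.lt_floor_add_one u
    linarith

lemma tendsto_interpolate {a : ℕ → V} {l : V} (h : Tendsto a atTop (𝓝 l)) :
    Tendsto (interpolate a) atTop (𝓝 l) := by
  refine Metric.tendsto_nhds.2 fun ε hε => ?_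
  obtain ⟨N, hN⟩ := Filter.eventually_atTop.1 (Metric.tendsto_nhds.1 h ε hε)
  filter_upwards [Filter.eventually_ge_atTop (N : ℝ≥0)] with u hu
  have hu' : N ≤ ⌊u⌋₊ := Nat.le_floor hu
  exact interpolate_mem (convex_ball l ε) fun n hn => hN n (hu'.trans hn)

lemma interpolate_apply (f : ℕ → C(I, ℝ)) (u : ℝ≥0) (t : I) :
    interpolate f u t = interpolate (fun n => f n t) u := by
  simp [interpolate, AffineMap.lineMap_apply]

/-- The set is taken inside `C(I, ℝ)`, where linear interpolation makes sense. For strict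
monotonicity one of the two weights must be positive. -/
lemma Reparam.convex_maps (P : Reparam) :
    Convex ℝ {f : C(I, ℝ) | ∃ φ ∈ P.maps, ∀ t, f t = φ t} := by
  rintro f ⟨φ, hφ, hf⟩ g ⟨ψ, hψ, hg⟩ a b ha hb hab
  rw [P.mem_maps_iff] at hφ hψ
  have hle : ∀ t, a * (φ t : ℝ) + b * ψ t ≤ 1 := fun t => by
    have h1 := mul_le_mul_of_nonneg_left (φ t).2.2 ha
    have h2 := mul_le_mul_of_nonneg_left (ψ t).2.2 hb
    linarith
  refine ⟨⟨fun t => ⟨a * φ t + b * ψ t, ?_, hle t⟩, by fun_prop⟩, ?_, fun t => ?_⟩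
  · exact add_nonneg (mul_nonneg ha (φ t).2.1) (mul_nonneg hb (ψ t).2.1)
  · rw [P.mem_maps_iff]
    refine ⟨fun s t hst => Subtype.mk_le_mk.2 ?_, Subtype.ext ?_, Subtype.ext ?_,
      fun hG s t hst => Subtype.mk_lt_mk.2 ?_⟩
    · exact add_le_add (mul_le_mul_of_nonneg_left (hφ.1 hst) ha)
        (mul_le_mul_of_nonneg_left (hψ.1 hst) hb)
    · simp [hφ.2.1, hψ.2.1]
    · simp [hφ.2.2.1, hψ.2.2.1, hab]
    · have h1 : (φ s : ℝ) < φ t := hφ.2.2.2 hG hst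
      have h2 : (ψ s : ℝ) < ψ t := hψ.2.2.2 hG hst
      obtain ha' | ha' := ha.lt_or_eq
      · exact add_lt_add_of_lt_of_le (mul_lt_mul_of_pos_left h1 ha')
          (mul_le_mul_of_nonneg_left h2.le hb)
      · have hb' : 0 < b := by linarith
        exact add_lt_add_of_le_of_lt (mul_le_mul_of_nonneg_left h1.le ha)
          (mul_lt_mul_of_pos_left h2 hb')
  · simp [hf, hg]

variable {U : Type*} [TopologicalSpace U] [T2Space U]

/-- The value at `t₀` of a limit of reparametrized paths `F n ∘ φ n` is the value of the limit of
the paths `F n` at any parameter enclosed by the limits of the `φ n` near `t₀`. -/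
lemma eq_of_tendsto_reparametrized {P : Reparam} {F : ℕ → C(I, U)} {F' : C(I, U)}
    (hF : Tendsto F atTop (𝓝 F')) {φ : ℕ → C(I, I)} (hφ : ∀ n, φ n ∈ P.maps) {γ : C(I, U)}
    (hγ : Tendsto (fun n => (F n).comp (φ n)) atTop (𝓝 γ)) {g : ℚ → I}
    (hg : ∀ q : ℚ, Tendsto (fun n => φ n (Set.projIcc 0 1 zero_le_one (q : ℝ))) atTop (𝓝 (g q)))
    {t₀ c : I} (hl : ∀ q : ℚ, (q : ℝ) < t₀ → g q ≤ c) (hr : ∀ q : ℚ, (t₀ : ℝ) < q → c ≤ g q) :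
    F' c = γ t₀ := by
  let pr : ℝ → I := Set.projIcc 0 1 zero_le_one
  have hpr : Continuous pr := continuous_projIcc
  by_contra hne
  have hopen : IsOpen {t : ℝ | γ (pr t) ≠ F' c} :=
    isOpen_ne.preimage (γ.continuous.comp hpr)
  have ht₀ : (t₀ : ℝ) ∈ {t : ℝ | γ (pr t) ≠ F' c} := by
    change γ (Set.projIcc 0 1 zero_le_one (t₀ : ℝ)) ≠ F' c
    rw [Set.projIcc_val]
    exact fun h => hne h.symm
  obtain ⟨ε, hε, hball⟩ := Metric.isOpen_iff.1 hopen _ ht₀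
  obtain ⟨q, hq1, hq2⟩ := exists_rat_btwn (show (t₀ : ℝ) - ε < t₀ by linarith)
  obtain ⟨q', hq1', hq2'⟩ := exists_rat_btwn (show (t₀ : ℝ) < t₀ + ε by linarith)
  have hqq : (q : ℝ) ≤ q' := (hq2.trans hq1').le
  -- The value `c` is clamped between `φ n q` and `φ n q'`. The hypotheses on `c` give `y n → c`,
  -- while the intermediate value theorem realises `y n` at a time in `[q, q']`; a limit of such
  -- times is a point near `t₀` where `γ` equals `F' c`.
  let y : ℕ → I := fun n => max (φ n (pr q)) (min c (φ n (pr q')))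
  have hy : Tendsto y atTop (𝓝 c) := by
    have h : Tendsto y atTop (𝓝 (max (g q) (min c (g q')))) :=
      (hg q).max (tendsto_const_nhds.min (hg q'))
    rwa [min_eq_left (hr q' hq1'), max_eq_right (hl q hq2)] at h
  have hx : ∀ n, ∃ x ∈ Set.Icc (q : ℝ) q', φ n (pr x) = y n := by
    intro n
    refine intermediate_value_Icc hqq (f := fun x => φ n (pr x))
      ((φ n).continuous.comp hpr).continuousOn ⟨le_max_left _ _, max_le ?_ (min_le_right _ _)⟩
    exact P.monotone (hφ n) (Set.monotone_projIcc _ hqq)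
  choose x hx hxy using hx
  obtain ⟨x', hx', k, hk, hlim⟩ := isCompact_Icc.tendsto_subseq hx
  have heval : Continuous fun p : C(I, U) × I => p.1 p.2 := by fun_prop
  have h1 : Tendsto (fun n => F (k n) (y (k n))) atTop (𝓝 (F' c)) :=
    (heval.tendsto (F', c)).comp
      ((hF.comp hk.tendsto_atTop).prodMk_nhds (hy.comp hk.tendsto_atTop))
  have h2 : Tendsto (fun n => ((F (k n)).comp (φ (k n))) (pr (x (k n)))) atTop
      (𝓝 (γ (pr x'))) :=
    (heval.tendsto (γ, pr x')).comp
      ((hγ.comp hk.tendsto_atTop).prodMk_nhds ((hpr.tendsto x').comp hlim))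
  have h3 : γ (pr x') = F' c := by
    refine tendsto_nhds_unique h2 (h1.congr fun n => ?_)
    rw [ContinuousMap.comp_apply, hxy]
  refine hball (?_ : x' ∈ Metric.ball (t₀ : ℝ) ε) h3
  rw [Metric.mem_ball, Real.dist_eq, abs_lt]
  exact ⟨by linarith [hx'.1], by linarith [hx'.2]⟩

/-- Parameters and reparametrizations are interpolated linearly along `[0, ∞)`, and `s = 1/u`
compactifies this half-line with `γ` at `s = 0`. Convexity keeps every interpolated value
admissible. -/
lemma exists_path_of_tendsto {P : Reparam} {K : Set V} (hKc : Convex ℝ K) (F : C(K, C(I, U)))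
    {v : ℕ → K} {v' : K} (hv : Tendsto v atTop (𝓝 v')) {φ : ℕ → C(I, I)}
    (hφ : ∀ n, φ n ∈ P.maps) {γ : C(I, U)}
    (hγ : Tendsto (fun n => (F (v n)).comp (φ n)) atTop (𝓝 γ)) {g : ℚ → I}
    (hg : ∀ q : ℚ, Tendsto (fun n => φ n (Set.projIcc 0 1 zero_le_one (q : ℝ))) atTop (𝓝 (g q))) :
    ∃ H : C(I, C(I, U)), H 0 = γ ∧ (∀ s : I, s ≠ 0 → ∃ w, ∃ ψ ∈ P.maps, H s = (F w).comp ψ) ∧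
      ∃ᶠ s : I in 𝓝 0, ∃ n, H s = (F (v n)).comp (φ n) := by
  let w : ℝ≥0 → K := fun u =>
    ⟨interpolate (fun n => (v n : V)) u, interpolate_mem hKc fun n _ => (v n).2⟩
  have hw : Continuous w := (continuous_interpolate _).subtype_mk _
  have hv₀ : Tendsto (fun n => (v n : V)) atTop (𝓝 (v' : V)) :=
    (continuous_subtype_val.tendsto v').comp hv
  have hw' : Tendsto w atTop (𝓝 v') := by
    have h := tendsto_interpolate hv₀
    exact tendsto_subtype_rng.2 h
  have hwn : ∀ n : ℕ, w (n : ℝ≥0) = v n := by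
    intro n
    have h := interpolate_natCast (fun n => (v n : V)) n
    exact Subtype.ext h
  let f : ℕ → C(I, ℝ) := fun n => ⟨fun t => (φ n t : ℝ), by fun_prop⟩
  have hex : ∀ u : ℝ≥0, ∃ ψ ∈ P.maps, ∀ t, interpolate f u t = ψ t := fun u =>
    interpolate_mem P.convex_maps fun n _ => ⟨φ n, hφ n, fun t => rfl⟩
  choose ψ hψ hfψ using hex
  have hψn : ∀ n : ℕ, ψ (n : ℝ≥0) = φ n := fun n => ContinuousMap.ext fun t => Subtype.ext (by
    rw [← hfψ, interpolate_natCast]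
    rfl)
  have hψc : Continuous fun p : ℝ≥0 × I => ψ p.1 p.2 := by
    refine continuous_induced_rng.2 ?_
    have h : Continuous fun p : ℝ≥0 × I => interpolate f p.1 p.2 :=
      ((continuous_interpolate f).comp continuous_fst).eval continuous_snd
    exact h.congr fun p => hfψ _ _
  have hψg : ∀ q : ℚ, Tendsto (fun u => ψ u (Set.projIcc 0 1 zero_le_one (q : ℝ))) atTop
      (𝓝 (g q)) := fun q => by
    refine tendsto_subtype_rng.2 ?_
    have hg' : Tendsto (fun n => (φ n (Set.projIcc 0 1 zero_le_one (q : ℝ)) : ℝ)) atTop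
        (𝓝 (g q : ℝ)) := (continuous_subtype_val.tendsto (g q)).comp (hg q)
    refine (tendsto_interpolate hg').congr fun u => ?_
    rw [← hfψ, interpolate_apply]
    rfl
  let G : ℝ≥0 × I → U := fun p => F (w p.1) (ψ p.1 p.2)
  have hG : Continuous G := (F.continuous.comp (hw.comp continuous_fst)).eval hψc
  let inv : I → ℝ≥0 := fun s => Real.toNNReal ((s : ℝ)⁻¹)
  let H : I → C(I, U) := fun s => if s = 0 then γ else (F (w (inv s))).comp (ψ (inv s))
  have hH0 : H 0 = γ := if_pos rfl
  have hH1 : ∀ s ≠ 0, H s = (F (w (inv s))).comp (ψ (inv s)) := fun s hs => if_neg hs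
  have hcoe : ∀ s : I, s ≠ 0 → (s : ℝ) ≠ 0 := fun s hs h => hs (Subtype.ext h)
  have hinv0 : Tendsto inv (𝓝[≠] 0) atTop := by
    refine tendsto_real_toNNReal_atTop.comp (tendsto_inv_nhdsGT_zero.comp
      (tendsto_nhdsWithin_iff.2 ⟨?_, ?_⟩))
    · exact (continuous_subtype_val.tendsto (0 : I)).mono_left nhdsWithin_le_nhds
    · filter_upwards [self_mem_nhdsWithin] with s hs
      exact lt_of_le_of_ne s.2.1 (hcoe s hs).symm
  have hHc : Continuous (Function.uncurry fun s t => H s t) := by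
    refine continuous_iff_continuousAt.2 fun ⟨s₀, t₀⟩ => ?_
    by_cases hs : s₀ = 0
    · subst hs
      -- The reparametrized times need not converge as `s → 0`; along an ultrafilter they do, by
      -- compactness of `I`, and every possible limit gives the same value `γ t₀`.
      refine (tendsto_iff_ultrafilter _ _ _).2 fun 𝒰 h𝒰 => ?_
      have hf : Tendsto Prod.fst (𝒰 : Filter (I × I)) (𝓝 0) :=
        (continuous_fst.tendsto ((0 : I), t₀)).mono_left h𝒰
      have hs : Tendsto Prod.snd (𝒰 : Filter (I × I)) (𝓝 t₀) :=
        (continuous_snd.tendsto ((0 : I), t₀)).mono_left h𝒰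
      change Tendsto _ _ (𝓝 (H 0 t₀))
      rw [hH0]
      by_cases hmem : {p : I × I | p.1 = 0} ∈ 𝒰
      · refine Tendsto.congr' ?_ ((γ.continuous.tendsto t₀).comp hs)
        filter_upwards [hmem] with p hp
        change γ p.2 = H p.1 p.2
        rw [show p.1 = 0 from hp, hH0]
      · have hne : {p : I × I | p.1 ≠ 0} ∈ 𝒰 := Ultrafilter.compl_mem_iff_notMem.2 hmem
        have hinv : Tendsto (fun p : I × I => inv p.1) 𝒰 atTop :=
          hinv0.comp (tendsto_nhdsWithin_iff.2 ⟨hf, hne⟩)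
        obtain ⟨c, -, hc⟩ := (isCompact_univ (X := I)).ultrafilter_le_nhds
          (𝒰.map fun p => ψ (inv p.1) p.2) (by simp)
        have hc' : Tendsto (fun p : I × I => ψ (inv p.1) p.2) 𝒰 (𝓝 c) := hc
        have hlim : Tendsto (fun p : I × I => F (w (inv p.1)) (ψ (inv p.1) p.2)) 𝒰
            (𝓝 (F v' c)) := by
          have heval : Continuous fun p : C(I, U) × I => p.1 p.2 := by fun_prop
          exact (heval.tendsto (F v', c)).comp
            (((F.continuous.tendsto v').comp (hw'.comp hinv)).prodMk_nhds hc')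
        have heq : F v' c = γ t₀ := by
          have hs' : Tendsto (fun p : I × I => (p.2 : ℝ)) 𝒰 (𝓝 (t₀ : ℝ)) :=
            (continuous_subtype_val.tendsto t₀).comp hs
          -- Monotonicity of the interpolated reparametrizations traps `c` between their limits at
          -- rational times on either side of `t₀`.
          refine eq_of_tendsto_reparametrized ((F.continuous.tendsto v').comp hv) hφ hγ hg ?_ ?_
          · intro q hq
            refine le_of_tendsto_of_tendsto ((hψg q).comp hinv) hc' ?_
            filter_upwards [hs'.eventually (lt_mem_nhds hq)] with p hp
            refine P.monotone (hψ _) ?_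
            have h := Set.monotone_projIcc (zero_le_one (α := ℝ)) hp.le
            rwa [Set.projIcc_val] at h
          · intro q hq
            refine le_of_tendsto_of_tendsto hc' ((hψg q).comp hinv) ?_
            filter_upwards [hs'.eventually (gt_mem_nhds hq)] with p hp
            refine P.monotone (hψ _) ?_
            have h := Set.monotone_projIcc (zero_le_one (α := ℝ)) hp.le
            rwa [Set.projIcc_val] at h
        rw [← heq]
        refine hlim.congr' ?_
        filter_upwards [hne] with p hp
        change _ = H p.1 p.2
        rw [hH1 _ hp]
        rfl
    · have hinvc : ContinuousAt inv s₀ := by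
        refine continuous_real_toNNReal.continuousAt.comp ?_
        exact continuous_subtype_val.continuousAt.inv₀ (hcoe s₀ hs)
      have h : ContinuousAt (fun p : I × I => G (inv p.1, p.2)) (s₀, t₀) := by
        refine ContinuousAt.comp (g := G) hG.continuousAt (ContinuousAt.prodMk ?_ continuousAt_snd)
        exact ContinuousAt.comp (g := inv) (f := Prod.fst) (x := (s₀, t₀)) hinvc continuousAt_fst
      refine h.congr ?_
      filter_upwards [(isOpen_ne (x := (0 : I))).preimage continuous_fst |>.mem_nhds
        (show (s₀, t₀) ∈ Prod.fst ⁻¹' {y : I | y ≠ 0} from hs)] with p hp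
      change _ = H p.1 p.2
      rw [hH1 _ hp]
      rfl
  refine ⟨⟨H, ContinuousMap.continuous_of_continuous_uncurry _ hHc⟩, hH0,
    fun s hs => ⟨_, _, hψ _, hH1 s hs⟩, ?_⟩
  let s : ℕ → I := fun n => ⟨((n + 1 : ℕ) : ℝ)⁻¹, by positivity, by
    exact Nat.cast_inv_le_one _⟩
  have hs : Tendsto s atTop (𝓝 0) := by
    refine tendsto_subtype_rng.2 ?_
    exact (tendsto_inv_atTop_zero.comp tendsto_natCast_atTop_atTop).comp (tendsto_add_atTop_nat 1)
  -- At `s n = 1/(n+1)` the interpolation parameter is the integer `n+1`, where the original term of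
  -- that index is recovered.
  refine hs.frequently (Frequently.of_forall fun n => ⟨n + 1, ?_⟩)
  have hsn : s n ≠ 0 := fun h => by
    have := congrArg Subtype.val h
    have h' : ((n + 1 : ℕ) : ℝ)⁻¹ ≠ 0 := by positivity
    exact h' this
  have hin : inv (s n) = ((n + 1 : ℕ) : ℝ≥0) := by
    change Real.toNNReal ((((n + 1 : ℕ) : ℝ)⁻¹)⁻¹) = _
    rw [inv_inv, Real.toNNReal_natCast]
  change H (s n) = _
  rw [hH1 _ hsn, hin, hwn, hψn]

/-- A convergent sequence of reparametrized paths, the paths being parametrized by a compact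
convex set, has a subsequence which lies on a continuous path of such reparametrized paths. -/
theorem exists_path_of_tendsto_reparametrized {P : Reparam} {K : Set V} (hK : IsCompact K)
    (hKc : Convex ℝ K) (F : C(K, C(I, U))) (v : ℕ → K) {φ : ℕ → C(I, I)}
    (hφ : ∀ n, φ n ∈ P.maps) {γ : C(I, U)}
    (hγ : Tendsto (fun n => (F (v n)).comp (φ n)) atTop (𝓝 γ)) :
    ∃ H : C(I, C(I, U)), H 0 = γ ∧ (∀ s : I, s ≠ 0 → ∃ w, ∃ ψ ∈ P.maps, H s = (F w).comp ψ) ∧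
      ∃ᶠ s : I in 𝓝 0, ∃ n, H s = (F (v n)).comp (φ n) := by
  have := isCompact_iff_compactSpace.1 hK
  let x : ℕ → K × (ℚ → I) := fun n => (v n, fun q => φ n (Set.projIcc 0 1 zero_le_one (q : ℝ)))
  -- A Helly-type selection: the product of `K` with countably many copies of `I` is sequentially
  -- compact.
  obtain ⟨⟨v', g⟩, k, hk, hx⟩ := CompactSpace.tendsto_subseq x
  obtain ⟨hv, hg⟩ := Prod.tendsto_iff _ _ |>.1 hx
  obtain ⟨H, h0, h1, h2⟩ := exists_path_of_tendsto hKc F hv (fun n => hφ (k n))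
    (hγ.comp hk.tendsto_atTop) (fun q => (tendsto_pi_nhds.1 hg q))
  exact ⟨H, h0, h1, h2.mono fun s ⟨n, hn⟩ => ⟨k n, hn⟩⟩

end Interpolation

/-! ### The topology of the space of execution paths -/

/-- A probe into the induced topology, composed with `f`, is a probe into `Z`, hence is continuous
into the generated topology of `Z`. Generating the topology of `Z` beforehand therefore loses no
probe. -/
lemma generatedBy_induced_le {ι : Type*} (A : ι → Type*) [∀ i, TopologicalSpace (A i)]
    {Y Z : Type*} [tZ : TopologicalSpace Z] (f : Y → Z) :
    TopologicalSpace.generatedBy A (tY := TopologicalSpace.induced f tZ) ≤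
      TopologicalSpace.generatedBy A
        (tY := TopologicalSpace.induced f (TopologicalSpace.generatedBy A)) := by
  refine iSup₂_le fun i g => ?_
  let t : TopologicalSpace Y := TopologicalSpace.induced f (TopologicalSpace.generatedBy A)
  let g₀ : A i → Y := @ContinuousMap.toFun _ _ _ (TopologicalSpace.induced f tZ) g
  have hg : @Continuous _ _ _ (TopologicalSpace.induced f tZ) g₀ :=
    @ContinuousMap.continuous_toFun _ _ _ (TopologicalSpace.induced f tZ) g
  let h : C(A i, Z) := ⟨f ∘ g₀, continuous_induced_rng.1 hg⟩
  have hg₀ : Continuous g₀ := by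
    refine continuous_induced_rng.2 (continuous_iff_coinduced_le.2 ?_)
    exact le_iSup₂_of_le (f := fun (i : ι) (h : C(A i, Z)) =>
      TopologicalSpace.coinduced h inferInstance) i h le_rfl
  exact le_iSup₂_of_le (f := fun (i : ι) (h : C(A i, Y)) =>
      TopologicalSpace.coinduced h inferInstance) i ⟨g₀, hg₀⟩ le_rfl

namespace CellularMDSpace

open MDSpace

variable {T : Ambient} {P : Reparam} {X : CellularMDSpace.{u} T P}

/-- A convergent sequence of execution paths of a locally finite cellular multipointed d-space has
a subsequence which lies on a continuous path of execution paths. -/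
theorem LocallyFinite.exists_path_of_tendsto (hX : X.LocallyFinite) {α β : X.total}
    {γ : ℕ → C(I, X.total)} {γ' : C(I, X.total)} (hγ : Filter.Tendsto γ Filter.atTop (𝓝 γ'))
    (hp : ∀ n, γ n ∈ X.total.paths ∧ γ n 0 = α ∧ γ n 1 = β) :
    ∃ H : C(I, C(I, X.total)), H 0 = γ' ∧
      (∀ s : I, s ≠ 0 → H s ∈ X.total.paths ∧ H s 0 = α ∧ H s 1 = β) ∧
      ∃ᶠ s : I in 𝓝 0, ∃ n, H s = γ n := by
  obtain ⟨a, ha⟩ := hX.exists_frequently_isComposite hγ fun n => (hp n).1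
  obtain ⟨k, hk, hc⟩ := Filter.extraction_of_frequently_atTop ha
  choose c hc φ hφ hcφ using hc
  obtain ⟨V, _, _, K, F, hK, hKc, hF⟩ := exists_parametrization a
  have hFa : ∀ v, X.IsComposite a (F v) := fun v => by
    have : F v ∈ {γ | X.IsComposite a γ} := hF ▸ ⟨v, rfl⟩
    exact this
  have hv : ∀ n, ∃ v, F v = c n := fun n => by
    have : c n ∈ Set.range F := hF ▸ hc n
    exact this
  choose v hv using hv
  have hγ' : ∀ n, γ (k n) = (F (v n)).comp (φ n) := fun n => by rw [hv, hcφ]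
  obtain ⟨H, h0, h1, h2⟩ := exists_path_of_tendsto_reparametrized hK hKc F v hφ
    ((hγ.comp hk.tendsto_atTop).congr hγ')
  refine ⟨H, h0, fun s hs => ?_, h2.mono fun s ⟨n, hn⟩ => ⟨k n, hn.trans (hγ' n).symm⟩⟩
  obtain ⟨w, ψ, hψ, h⟩ := h1 s hs
  -- All composites of the word share their endpoints, so the interpolated paths still run from `α`
  -- to `β`.
  have hend := (hFa w).endpoints (hc 0)
  have h3 := (hp (k 0)).2
  rw [hcφ 0, ContinuousMap.comp_apply, ContinuousMap.comp_apply, P.map_zero (hφ 0),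
    P.map_one (hφ 0), ← hend.1, ← hend.2] at h3
  rw [h, ContinuousMap.comp_apply, ContinuousMap.comp_apply, P.map_zero hψ, P.map_one hψ]
  exact ⟨X.total.reparam_mem _ (hFa w).mem_paths _ hψ, h3⟩

/-- The compact-open topology on the set of execution paths between two points is
Δ-generated. -/
theorem LocallyFinite.deltaGenerated_execPath (hX : X.LocallyFinite) (α β : X.total) :
    @DeltaGeneratedSpace (X.total.ExecPath α β) (X.total.execCoTopology α β) := by
  have := hX.metrizableSpace_total
  let := X.total.execCoTopology α β
  have hind : IsInducing (Subtype.val : X.total.ExecPath α β → C(I, X.total)) := ⟨rfl⟩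
  have : FirstCountableTopology (X.total.ExecPath α β) := hind.firstCountableTopology
  refine IsGeneratedBy.iff_le_generatedBy.2 fun A hA => ?_
  -- Probes from the real line suffice: the path `H` is extended to it by projection onto `[0,1]`.
  have hA' : ∀ f : C(Fin 1 → ℝ, X.total.ExecPath α β), IsOpen (f ⁻¹' A) := fun f =>
    (WithGeneratedByTopology.isOpen_iff (X := fun n ↦ Fin n → ℝ)
      (Y := X.total.ExecPath α β) (U := A)).1 hA f
  refine isClosed_compl_iff.1 (isClosed_iff_clusterPt.2 fun γ' hγ' hmem => ?_)
  obtain ⟨γ, hγA, hγ⟩ := mem_closure_iff_seq_limit.1 (mem_closure_iff_clusterPt.2 hγ')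
  obtain ⟨H, h0, h1, h2⟩ := hX.exists_path_of_tendsto
    (((hind.continuous).tendsto γ').comp hγ) fun n => (γ n).2
  have hH : ∀ s, H s ∈ X.total.paths ∧ H s 0 = α ∧ H s 1 = β := fun s => by
    by_cases hs : s = 0
    · rw [hs, h0]
      exact γ'.2
    · exact h1 s hs
  let G : I → X.total.ExecPath α β := fun s => ⟨H s, hH s⟩
  have hG : Continuous G := hind.continuous_iff.2 H.continuous
  let f : C(Fin 1 → ℝ, X.total.ExecPath α β) :=
    ⟨fun x => G (Set.projIcc 0 1 zero_le_one (x 0)),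
      hG.comp (continuous_projIcc.comp (continuous_apply 0))⟩
  have hopen : IsOpen (G ⁻¹' A) := by
    have h := (hA' f).preimage (f := fun s : I => fun _ : Fin 1 => (s : ℝ)) (by fun_prop)
    convert h using 1
    ext s
    change G s ∈ A ↔ G (Set.projIcc 0 1 zero_le_one (s : ℝ)) ∈ A
    rw [Set.projIcc_val]
  have h0A : G 0 ∈ A := by
    rwa [show G 0 = γ' from Subtype.ext h0]
  -- Near `0` the path stays in `A`, yet it passes through terms of the sequence arbitrarily close
  -- to `0`, all of which lie outside `A`.
  obtain ⟨s, ⟨n, hn⟩, hs⟩ := (h2.and_eventually (hopen.mem_nhds h0A)).exists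
  refine hγA n ?_
  rwa [← show G s = γ n from Subtype.ext hn]

/-- Kelleyfication only refines, and a Δ-generated topology is not refined at all. -/
theorem LocallyFinite.execTopology_eq (hX : X.LocallyFinite) (α β : X.total) :
    X.total.execTopology α β = X.total.execCoTopology α β := by
  refine le_antisymm ?_ ?_
  · exact generatedBy_le.trans (induced_mono generatedBy_le)
  · refine (IsGeneratedBy.iff_le_generatedBy.1 (hX.deltaGenerated_execPath α β)).trans ?_
    exact generatedBy_induced_le _ _

theorem LocallyFinite.allExecTopology_eq (hX : X.LocallyFinite) :
    X.total.allExecTopology = X.total.allExecCoTopology := by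
  have h : X.total.allExecTopology = @instTopologicalSpaceSigma _ _
      fun p : X.total.states × X.total.states => X.total.execCoTopology p.1 p.2 :=
    congrArg (fun t : ∀ p : X.total.states × X.total.states,
      TopologicalSpace (X.total.ExecPath p.1 p.2) => @instTopologicalSpaceSigma _ _ t)
      (funext fun p => hX.execTopology_eq p.1 p.2)
  rw [h]
  refine le_antisymm ?_ ?_
  · refine continuous_iff_le_induced.1 ?_
    let := fun p : X.total.states × X.total.states => X.total.execCoTopology p.1 p.2
    exact continuous_sigma fun p => continuous_induced_dom
  · intro A hA
    let := X.total.allExecCoTopology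
    refine isOpen_iff_mem_nhds.2 ?_
    rintro ⟨⟨α, β⟩, γ⟩ hγ
    let := fun p : X.total.states × X.total.states => X.total.execCoTopology p.1 p.2
    obtain ⟨W, hW, hWA⟩ := isOpen_induced_iff.1 (isOpen_sigma_iff.1 hA (α, β))
    -- The states other than `α` form a thin, hence closed, set; fixing the endpoints is thus an
    -- open condition on execution paths, and the summands are open in the compact-open topology.
    have hstate : ∀ α : X.total.states, IsOpen (X.total.states \ {(α : X.total)})ᶜ := fun α =>
      (thin_states.mono Set.sdiff_subset : Thin (X := X) _).isClosed.isOpen_compl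
    have hopen : IsOpen (AllExecPath.toPath ⁻¹' (W ∩
        ((fun c : C(I, X.total) => c 0) ⁻¹' (X.total.states \ {(α : X.total)})ᶜ ∩
          (fun c : C(I, X.total) => c 1) ⁻¹' (X.total.states \ {(β : X.total)})ᶜ))) := by
      refine IsOpen.preimage continuous_induced_dom (hW.inter (IsOpen.inter ?_ ?_))
      · exact (hstate α).preimage (continuous_eval_const 0)
      · exact (hstate β).preimage (continuous_eval_const 1)
    refine Filter.mem_of_superset (hopen.mem_nhds ⟨?_, ?_, ?_⟩) ?_
    · have h : γ ∈ Subtype.val ⁻¹' W := hWA ▸ hγ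
      exact h
    · exact fun h => h.2 γ.2.2.1
    · exact fun h => h.2 γ.2.2.2
    · rintro ⟨⟨α', β'⟩, γ'⟩ ⟨h1, h2, h3⟩
      obtain rfl : α' = α := by
        by_contra hne
        refine h2 ?_
        change γ'.1 0 ∈ _
        rw [γ'.2.2.1]
        exact ⟨α'.2, fun h => hne (Subtype.ext h)⟩
      obtain rfl : β' = β := by
        by_contra hne
        refine h3 ?_
        change γ'.1 1 ∈ _
        rw [γ'.2.2.2]
        exact ⟨β'.2, fun h => hne (Subtype.ext h)⟩
      have h : γ' ∈ Sigma.mk (α', β') ⁻¹' A := hWA ▸ h1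
      exact h

lemma toPath_injective : Function.Injective (AllExecPath.toPath (X := X.total)) := by
  rintro ⟨⟨α, β⟩, γ⟩ ⟨⟨α', β'⟩, γ'⟩ h
  have h' : γ.1 = γ'.1 := h
  obtain rfl : α = α' := Subtype.ext (by rw [← γ.2.2.1, ← γ'.2.2.1, h'])
  obtain rfl : β = β' := Subtype.ext (by rw [← γ.2.2.2, ← γ'.2.2.2, h'])
  rw [show γ = γ' from Subtype.ext h']

end CellularMDSpace

/-! ### Assembly of the theorem. -/

theorem mainTheorem6 (T : Ambient) (P : Reparam) (X : CellularMDSpace.{u} T P)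
    (hX : X.LocallyFinite) :
    (∀ α ∈ X.total.states, ∀ β ∈ X.total.states,
      @DeltaGeneratedSpace (X.total.ExecPath α β) (X.total.execCoTopology α β)) ∧
    MetrizableSpace X.total ∧
    (∀ d : MetricSpace X.total,
      d.toPseudoMetricSpace.toUniformSpace.toTopologicalSpace = X.total.top →
      ∃ D : MetricSpace X.total.AllExecPath,
        D.toPseudoMetricSpace.toUniformSpace.toTopologicalSpace = X.total.allExecTopology ∧
        ∀ γ₁ γ₂ : X.total.AllExecPath,
          IsLUB (Set.range fun t : I => d.dist (γ₁.toPath t) (γ₂.toPath t)) (D.dist γ₁ γ₂)) ∧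
    X.total.allExecTopology = X.total.allExecCoTopology := by
  refine ⟨fun α _ β _ => hX.deltaGenerated_execPath α β, hX.metrizableSpace_total,
    fun d hd => ?_, hX.allExecTopology_eq⟩
  let := d.replaceTopology hd.symm
  -- The sup metric on `C(I, X.total)` is pulled back along `toPath`, which is injective because a
  -- path determines its endpoints.
  refine ⟨MetricSpace.induced _ CellularMDSpace.toPath_injective inferInstance, ?_,
    fun γ₁ γ₂ => ?_⟩
  · rw [hX.allExecTopology_eq]
    rfl
  · have h : IsLUB (Set.range fun t : I => dist (γ₁.toPath t) (γ₂.toPath t))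
        (dist γ₁.toPath γ₂.toPath) := by
      rw [ContinuousMap.dist_eq_iSup]
      refine isLUB_ciSup ⟨dist γ₁.toPath γ₂.toPath, ?_⟩
      rintro _ ⟨t, rfl⟩
      exact ContinuousMap.dist_apply_le_dist t
    exact h
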